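/- There is an absolute constant $C>0$ such that the following holds for every $\epsilon\in(0,1)$, every integer $n\ge 1$, every unit vector $v\in\mathbb{R}^n$ (in the Euclidean norm) and every $\theta\in\mathbb{R}$. Let $k:=\left\lfloor\frac{1}{50\epsilon^4}\ln^4\frac1\epsilon\right\rfloor$, and let $D$ be a probability distribution on $\{\pm1\}^n$ for which there is a $k$-wise independent distribution $D'$ on $\{\pm1\}^n$ with $$d_{\mathrm{TV}}(D,D')=\tfrac12\sum_{x\in\{\pm1\}^n}|D(x)-D'(x)|\le n^{-\frac{42}{\epsilon^4}\ln^2\frac1\epsilon}.$$ Here $D'$ is called $k$-wise independent if for every set $S\subseteq\{1,\dots,n\}$ with $|S|\le k$ the marginal of $D'$ on the coordinates in $S$ is uniform on $\{\pm1\}^S$. Then there is a real polynomial $P$ in $n$ variables, of total degree at most $\frac{20}{\epsilon^4}\ln^2\frac1\epsilon$, such that $$\mathbb{E}_{x\sim D}\bigl[\,|P(x)-\mathrm{sign}(v\cdot x-\theta)|\,\bigr]\le C\,\epsilon ,$$ where $\mathrm{sign}(t)=1$ for $t\ge0$ and $\mathrm{sign}(t)=-1$ for $t<0$. -/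

import Mathlib

noncomputable section

namespace HalfspaceApprox

/-- The Boolean cube `{±1}^n`; `ℤˣ` is the two-element group `{1, -1}`. -/
abbrev Cube (n : ℕ) : Type := Fin n → ℤˣ

/-- A point of the cube, viewed as a vector of real numbers. -/
def toReal {n : ℕ} (x : Cube n) : Fin n → ℝ := fun i => (((x i : ℤˣ) : ℤ) : ℝ)

/-- A distribution on the cube is `k`-wise independent (`k`-wise uniform) if its marginal on any
set `S` of at most `k` coordinates is the uniform distribution on `{±1}^S`. For `k ≤ n` this is the
same as asking it for the sets of size exactly `k`; for `k ≥ n` it says that `D` is uniform. -/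
def KWiseIndependent {n : ℕ} (k : ℕ) (D : PMF (Cube n)) : Prop :=
  ∀ S : Finset (Fin n), S.card ≤ k →
    D.map (fun (x : Cube n) (i : S) => x i) = PMF.uniformOfFintype (S → ℤˣ)

/-- Total variation distance of two distributions on a finite set: half of the `L¹` distance of
their probability mass functions. -/
def tvDist {Ω : Type*} [Fintype Ω] (D D' : PMF Ω) : ℝ :=
  (1 / 2) * ∑ x, |(D x).toReal - (D' x).toReal|

/-- `D` is `δ`-close in total variation distance to a `k`-wise independent distribution. -/
def CloseToKWiseIndependent {n : ℕ} (δ : ℝ) (k : ℕ) (D : PMF (Cube n)) : Prop :=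
  ∃ D' : PMF (Cube n), KWiseIndependent k D' ∧ tvDist D D' ≤ δ

/-- Expectation of a real function under a distribution on a finite set. -/
def expect {Ω : Type*} [Fintype Ω] (D : PMF Ω) (f : Ω → ℝ) : ℝ :=
  ∑ x, (D x).toReal * f x

/-- The `±1`-valued sign, with value `1` at `0`. -/
def sgn (t : ℝ) : ℝ := if 0 ≤ t then 1 else -1

/-- The halfspace `x ↦ sign(v · x - θ)` on the cube. -/
def halfspace {n : ℕ} (v : EuclideanSpace ℝ (Fin n)) (θ : ℝ) (x : Cube n) : ℝ :=
  sgn (∑ i, v i * toReal x i - θ)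

end HalfspaceApprox

end

noncomputable section

namespace HalfspaceApprox

/-! The sign is smoothed, the smoothed sign is Taylor-expanded, and the few influential coordinates
are conditioned on.

Regular case: `v` has norm one and all coordinates at most `ε`. The normalised primitive `smoothSgn`
of the Fejér kernel is within `16 / |u|` of the sign and has an explicit Taylor polynomial
`sgnPoly`. Applied to `(v·x - θ) / ε²`, the smoothing error is `O(ε)` plus a multiple of the Fejér
kernel of `(v·x - θ) / ε`. Esseen's argument (`cubeAvg_fejer_le`) makes the uniform mean of this
kernel `O(ε)`. The Taylor error is an even moment over a factorial, small by the subgaussian bound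
once the degree is of order `ε⁻⁴` (`cubeAvg_pow_div_factorial_le`). All error terms are bounded by
polynomials in one linear form or by the Fejér kernel, itself close to a polynomial, so matching
moments carry the bounds to `k`-wise independence (`sum_abs_sgnPoly_sub_sgn_le`). For large `|θ|` a
constant suffices, by Chebyshev.

General case: a greedy choice of heavy coordinates (`exists_regularOutside_or_separates`) gives a
small set `H`. Either `v` is regular outside `H`, and the univariate approximations for the various
values on `H` are glued by `blend`; or `H` contains many coordinates of geometrically decreasing
weight, so that the head is anti-concentrated, dominates the tail, and `headPoly` suffices.

Passing from `D'` to `D` costs the total variation distance times the maximum of the error on the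
cube. This is negligible for large `n`; for small `n` the halfspace is itself a polynomial of
admissible degree. -/

/-! ### Taylor remainder of the cosine -/

open Nat in
/-- Integrating the bound `|f'| ≤ z ^ k / k!` from `0`. -/
lemma abs_le_pow_div_factorial_of_hasDerivAt {f f' : ℝ → ℝ} {k : ℕ}
    (hf : ∀ z, HasDerivAt f (f' z) z) (h0 : f 0 = 0)
    (hb : ∀ z, 0 ≤ z → |f' z| ≤ z ^ k / k !) {z : ℝ} (hz : 0 ≤ z) :
    |f z| ≤ z ^ (k + 1) / (k + 1)! := by
  have hB : ∀ x : ℝ, HasDerivAt (fun x : ℝ => x ^ (k + 1) / ((k + 1)! : ℝ)) (x ^ k / k !) x := by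
    intro x
    have h := (hasDerivAt_pow (k + 1) x).div_const ((k + 1)! : ℝ)
    refine h.congr_deriv ?_
    have : ((k + 1 : ℕ) : ℝ) ≠ 0 := by positivity
    rw [Nat.factorial_succ]
    push_cast at this ⊢
    have h2 : (k ! : ℝ) ≠ 0 := by positivity
    field_simp
  refine image_norm_le_of_norm_deriv_right_le_deriv_boundary (f := f) (f' := f') (a := 0) (b := z)
    (fun x _ => (hf x).continuousAt.continuousWithinAt) (fun x _ => (hf x).hasDerivWithinAt)
    (by simp [h0]) hB (fun x hx => by simpa using hb x hx.1) (Set.right_mem_Icc.2 hz)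

open Nat in
/-- Taylor polynomial of the cosine. -/
def cosTaylor (m : ℕ) (z : ℝ) : ℝ := ∑ j ∈ Finset.range m, (-1) ^ j * z ^ (2 * j) / (2 * j)!

open Nat in
/-- Taylor polynomial of the sine. -/
def sinTaylor (m : ℕ) (z : ℝ) : ℝ :=
  ∑ j ∈ Finset.range m, (-1) ^ j * z ^ (2 * j + 1) / (2 * j + 1)!

lemma hasDerivAt_sinTaylor (m : ℕ) (z : ℝ) : HasDerivAt (sinTaylor m) (cosTaylor m z) z := by
  unfold sinTaylor cosTaylor
  refine HasDerivAt.fun_sum fun j _ => ?_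
  have h := ((hasDerivAt_pow (2 * j + 1) z).const_mul ((-1 : ℝ) ^ j)).div_const
    ((2 * j + 1).factorial : ℝ)
  refine h.congr_deriv ?_
  rw [Nat.factorial_succ]
  push_cast
  field_simp

lemma hasDerivAt_cosTaylor (m : ℕ) (z : ℝ) :
    HasDerivAt (cosTaylor (m + 1)) (-sinTaylor m z) z := by
  have he : cosTaylor (m + 1) = fun z => (∑ j ∈ Finset.range m,
      (-1) ^ (j + 1) * z ^ (2 * j + 1 + 1) / ((2 * j + 1 + 1).factorial : ℝ)) + 1 := by
    funext z
    simp [cosTaylor, Finset.sum_range_succ', Nat.mul_add]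
  rw [he]
  refine HasDerivAt.add_const _ ?_
  unfold sinTaylor
  rw [← Finset.sum_neg_distrib]
  refine HasDerivAt.fun_sum fun j _ => ?_
  have h := ((hasDerivAt_pow (2 * j + 1 + 1) z).const_mul ((-1 : ℝ) ^ (j + 1))).div_const
    ((2 * j + 1 + 1).factorial : ℝ)
  refine h.congr_deriv ?_
  rw [Nat.factorial_succ (2 * j + 1)]
  push_cast
  field_simp
  ring

open Nat in
lemma abs_cos_sub_cosTaylor_le_aux (m : ℕ) : ∀ z : ℝ, 0 ≤ z →
    |Real.cos z - cosTaylor m z| ≤ z ^ (2 * m) / (2 * m)! := by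
  induction m with
  | zero => intro z _; simpa [cosTaylor] using Real.abs_cos_le_one z
  | succ m ih =>
    have hs : ∀ z : ℝ, 0 ≤ z → |Real.sin z - sinTaylor m z| ≤ z ^ (2 * m + 1) / (2 * m + 1)! :=
      fun z hz => abs_le_pow_div_factorial_of_hasDerivAt
        (f := fun z => Real.sin z - sinTaylor m z)
        (fun z => (Real.hasDerivAt_sin z).sub (hasDerivAt_sinTaylor m z))
        (by simp [sinTaylor]) ih hz
    intro z hz
    refine abs_le_pow_div_factorial_of_hasDerivAt (k := 2 * m + 1)
        (f := fun z => Real.cos z - cosTaylor (m + 1) z)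
        (fun z => (Real.hasDerivAt_cos z).sub (hasDerivAt_cosTaylor m z))
        (by simp [cosTaylor, Finset.sum_range_succ']) ?_ hz
    intro z hz
    have := hs z hz
    rwa [← abs_neg, neg_sub, neg_sub_neg, ← neg_sub, abs_neg, ← neg_sub, abs_neg]

open Nat in
lemma abs_cos_sub_cosTaylor_le (m : ℕ) (z : ℝ) :
    |Real.cos z - cosTaylor m z| ≤ z ^ (2 * m) / (2 * m)! := by
  have h := abs_cos_sub_cosTaylor_le_aux m |z| (abs_nonneg z)
  rw [Real.cos_abs, (even_two_mul m).pow_abs] at h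
  rwa [show cosTaylor m |z| = cosTaylor m z from
    Finset.sum_congr rfl fun j _ => by rw [(even_two_mul j).pow_abs]] at h

/-! ### The Fejér kernel -/

/-- The Fejér kernel `2 (1 - cos y) / y ^ 2`, as the cosine transform of the triangle function. -/
def fejer (y : ℝ) : ℝ := 2 * ∫ s in (0 : ℝ)..1, (1 - s) * Real.cos (s * y)

lemma continuous_fejer : Continuous fejer := by
  unfold fejer
  refine continuous_const.mul ?_
  exact intervalIntegral.continuous_parametric_intervalIntegral_of_continuous'
    (f := fun y s : ℝ => (1 - s) * Real.cos (s * y)) (by fun_prop) 0 1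

lemma fejer_neg (y : ℝ) : fejer (-y) = fejer y := by
  simp [fejer]

lemma fejer_eq {y : ℝ} (hy : y ≠ 0) : fejer y = 2 * (1 - Real.cos y) / y ^ 2 := by
  have hd : ∀ s ∈ Set.uIcc (0 : ℝ) 1, HasDerivAt
      (fun s => (1 - s) * Real.sin (s * y) / y - Real.cos (s * y) / y ^ 2)
      ((1 - s) * Real.cos (s * y)) s := by
    intro s _
    have h1 : HasDerivAt (fun s : ℝ => s * y) y s := by
      simpa using (hasDerivAt_id s).mul_const y
    have h2 : HasDerivAt (fun s : ℝ => 1 - s) (-1) s := by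
      simpa using (hasDerivAt_id s).const_sub 1
    have h := ((h2.mul h1.sin).div_const y).sub (h1.cos.div_const (y ^ 2))
    refine h.congr_deriv ?_
    field_simp
    ring
  unfold fejer
  rw [intervalIntegral.integral_eq_sub_of_hasDerivAt hd
    ((by fun_prop : Continuous fun s : ℝ => (1 - s) * Real.cos (s * y)).intervalIntegrable _ _)]
  simp
  field_simp
  ring

lemma fejer_zero : fejer 0 = 1 := by
  have h : ∫ s in (0 : ℝ)..1, (1 - s) = 1 / 2 := by
    rw [intervalIntegral.integral_sub (by simp) (by simp)]
    simp
    norm_num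
  simp [fejer, h]

lemma fejer_nonneg (y : ℝ) : 0 ≤ fejer y := by
  rcases eq_or_ne y 0 with rfl | hy
  · simp [fejer_zero]
  · rw [fejer_eq hy]
    have := Real.cos_le_one y
    have : 0 ≤ 1 - Real.cos y := by linarith
    positivity

lemma fejer_le {y : ℝ} (hy : y ≠ 0) : fejer y ≤ 4 / y ^ 2 := by
  rw [fejer_eq hy]
  have := Real.neg_one_le_cos y
  gcongr
  linarith

/-- From `cos y ≤ 1 - 2 y² / π²`. A positive lower bound near `0` lets the kernel dominate the
indicator of an interval, up to a constant. -/
lemma fejer_ge {y : ℝ} (hy : |y| ≤ 1) : 1 / 4 ≤ fejer y := by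
  rcases eq_or_ne y 0 with rfl | h0
  · rw [fejer_zero]; norm_num
  · rw [fejer_eq h0]
    have hpi := Real.pi_gt_three
    have hpi4 := Real.pi_le_four
    have h := Real.cos_le_one_sub_mul_cos_sq (x := y) (by linarith)
    have hy2 : 0 < y ^ 2 := by positivity
    rw [le_div_iff₀ hy2]
    have h3 : 1 / 8 ≤ 2 / Real.pi ^ 2 := by
      rw [div_le_div_iff₀ (by norm_num) (by positivity)]
      nlinarith
    nlinarith

open Nat in
/-- Taylor polynomial of the Fejér kernel. -/
def fejerTaylor (m : ℕ) (y : ℝ) : ℝ :=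
  ∑ j ∈ Finset.range m, 2 * (-1) ^ j * y ^ (2 * j) / (2 * j + 2)!

open Nat in
lemma abs_fejer_sub_fejerTaylor_le {m : ℕ} (hm : 0 < m) (y : ℝ) :
    |fejer y - fejerTaylor m y| ≤ y ^ (2 * m) / (2 * m)! := by
  rcases eq_or_ne y 0 with rfl | hy
  · obtain ⟨m, rfl⟩ := Nat.exists_eq_succ_of_ne_zero hm.ne'
    simp [fejer_zero, fejerTaylor, Finset.sum_range_succ']
  · have hy2 : 0 < y ^ 2 := by positivity
    have h1 : cosTaylor (m + 1) y = 1 - y ^ 2 * fejerTaylor m y / 2 := by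
      simp only [cosTaylor, fejerTaylor, Finset.sum_range_succ', Finset.mul_sum, Finset.sum_div]
      simp only [Nat.mul_add, mul_one, mul_zero, pow_zero, Nat.factorial_zero, Nat.cast_one,
        div_one]
      rw [add_comm, sub_eq_add_neg, ← Finset.sum_neg_distrib]
      congr 1
      refine Finset.sum_congr rfl fun j _ => ?_
      ring
    have h2 : fejer y - fejerTaylor m y =
        (-(2 / y ^ 2)) * (Real.cos y - cosTaylor (m + 1) y) := by
      rw [h1, fejer_eq hy]
      field_simp
      ring
    rw [h2, abs_mul, abs_neg, abs_of_pos (by positivity : 0 < 2 / y ^ 2)]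
    calc 2 / y ^ 2 * |Real.cos y - cosTaylor (m + 1) y|
        ≤ 2 / y ^ 2 * (y ^ (2 * (m + 1)) / (2 * (m + 1))!) := by
          gcongr; exact abs_cos_sub_cosTaylor_le _ _
      _ = y ^ (2 * m) * (2 / (2 * (m + 1))!) := by
          field_simp
          ring
      _ ≤ y ^ (2 * m) * (1 / (2 * m)!) := by
          refine mul_le_mul_of_nonneg_left ?_ ((even_two_mul m).pow_nonneg y)
          rw [div_le_div_iff₀ (by positivity) (by positivity)]
          rw [Nat.mul_add, Nat.factorial_succ, Nat.factorial_succ]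
          push_cast
          have : (0 : ℝ) < (2 * m)! := by positivity
          have hm' : (0 : ℝ) ≤ m := by positivity
          nlinarith [mul_nonneg hm' hm']
      _ = _ := by ring

/-! ### The smoothed sign and its Taylor polynomial -/

/-- The primitive of the Fejér kernel. -/
def fejerPrim (u : ℝ) : ℝ := ∫ y in (0 : ℝ)..u, fejer y

lemma hasDerivAt_fejerPrim (u : ℝ) : HasDerivAt fejerPrim (fejer u) u :=
  intervalIntegral.integral_hasDerivAt_right (continuous_fejer.intervalIntegrable _ _)
    (continuous_fejer.stronglyMeasurableAtFilter _ _) continuous_fejer.continuousAt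

lemma fejerPrim_zero : fejerPrim 0 = 0 := by simp [fejerPrim]

lemma fejerPrim_neg (u : ℝ) : fejerPrim (-u) = -fejerPrim u := by
  have h := intervalIntegral.integral_comp_neg (f := fejer) (a := 0) (b := u)
  simp only [fejer_neg, neg_zero] at h
  rw [fejerPrim, fejerPrim, h, intervalIntegral.integral_symm]

lemma monotone_fejerPrim : Monotone fejerPrim :=
  monotone_of_hasDerivAt_nonneg hasDerivAt_fejerPrim fejer_nonneg

/-- The bound `fejer u ≤ 4 / u²` is a bound by the derivative of `-4 / u`. This controls the tail of
the integral by `4 / a` without improper integrals. -/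
lemma fejerPrim_add_antitone : AntitoneOn (fun u => fejerPrim u + 4 / u) (Set.Ioi 0) := by
  have hd : ∀ u ∈ Set.Ioi (0 : ℝ),
      HasDerivAt (fun u => fejerPrim u + 4 / u) (fejer u - 4 / u ^ 2) u := by
    intro u hu
    have h := (hasDerivAt_fejerPrim u).add ((hasDerivAt_inv (ne_of_gt hu)).const_mul 4)
    refine h.congr_deriv ?_
    field_simp
    ring
  refine antitoneOn_of_deriv_nonpos (convex_Ioi 0)
    (fun u hu => (hd u hu).continuousAt.continuousWithinAt) ?_ ?_
  · intro u hu
    rw [interior_Ioi] at hu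
    exact (hd u hu).differentiableAt.differentiableWithinAt
  · intro u hu
    rw [interior_Ioi] at hu
    rw [(hd u hu).deriv]
    linarith [fejer_le (ne_of_gt hu)]

lemma fejerPrim_le_add {a : ℝ} (ha : 0 < a) (b : ℝ) : fejerPrim b ≤ fejerPrim a + 4 / a := by
  rcases le_total b a with h | h
  · have := monotone_fejerPrim h
    have : 0 < 4 / a := by positivity
    linarith
  · have hb : 0 < b := ha.trans_le h
    have h1 := fejerPrim_add_antitone (Set.mem_Ioi.2 ha) (Set.mem_Ioi.2 hb) h
    have : 0 < 4 / b := by positivity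
    simp only at h1
    linarith

/-- The total mass of the Fejér kernel on the half-line. -/
def fejerMass : ℝ := ⨆ u, fejerPrim u

lemma bddAbove_fejerPrim : BddAbove (Set.range fejerPrim) :=
  ⟨fejerPrim 1 + 4 / 1, by rintro _ ⟨b, rfl⟩; exact fejerPrim_le_add one_pos b⟩

lemma fejerPrim_le_mass (u : ℝ) : fejerPrim u ≤ fejerMass := le_ciSup bddAbove_fejerPrim u

lemma fejerMass_le {a : ℝ} (ha : 0 < a) : fejerMass ≤ fejerPrim a + 4 / a :=
  ciSup_le (fejerPrim_le_add ha)

/-- The exact value is `π`; only a positive lower bound matters, because the mass enters through its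
inverse. -/
lemma fejerMass_ge : 1 / 4 ≤ fejerMass := by
  refine le_trans ?_ (fejerPrim_le_mass 1)
  have h : ∫ _ in (0 : ℝ)..1, (1 / 4 : ℝ) ≤ ∫ y in (0 : ℝ)..1, fejer y :=
    intervalIntegral.integral_mono_on zero_le_one (by simp)
      (continuous_fejer.intervalIntegrable _ _)
      (fun y hy => fejer_ge (abs_le.2 ⟨by linarith [hy.1], hy.2⟩))
  simpa [fejerPrim] using h

/-- A smooth approximation of the sign function. -/
def smoothSgn (u : ℝ) : ℝ := fejerMass⁻¹ * fejerPrim u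

lemma smoothSgn_neg (u : ℝ) : smoothSgn (-u) = -smoothSgn u := by
  simp [smoothSgn, fejerPrim_neg]

lemma fejerMass_pos : 0 < fejerMass := lt_of_lt_of_le (by norm_num) fejerMass_ge

lemma fejerMass_inv_le : fejerMass⁻¹ ≤ 4 := by
  have := inv_anti₀ (by norm_num) fejerMass_ge
  simpa using this

lemma abs_smoothSgn_sub_one_le {u : ℝ} (hu : 0 ≤ u) : |smoothSgn u - 1| ≤ 1 := by
  have h1 : smoothSgn u ≤ 1 := by
    rw [smoothSgn, inv_mul_le_iff₀ fejerMass_pos, mul_one]; exact fejerPrim_le_mass u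
  have h2 : 0 ≤ smoothSgn u := mul_nonneg (inv_nonneg.2 fejerMass_pos.le)
    (by simpa [fejerPrim_zero] using monotone_fejerPrim hu)
  rw [abs_le]; constructor <;> linarith

lemma abs_smoothSgn_sub_one_le_div {u : ℝ} (hu : 0 < u) : |smoothSgn u - 1| ≤ 16 / u := by
  have h1 : smoothSgn u ≤ 1 := by
    rw [smoothSgn, inv_mul_le_iff₀ fejerMass_pos, mul_one]; exact fejerPrim_le_mass u
  rw [abs_sub_comm, abs_of_nonneg (by linarith)]
  have h2 : 1 - smoothSgn u = fejerMass⁻¹ * (fejerMass - fejerPrim u) := by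
    rw [smoothSgn, mul_sub, inv_mul_cancel₀ fejerMass_pos.ne']
  rw [h2]
  calc fejerMass⁻¹ * (fejerMass - fejerPrim u) ≤ 4 * (4 / u) :=
        mul_le_mul fejerMass_inv_le (by linarith [fejerMass_le hu])
          (by linarith [fejerPrim_le_mass u]) (by norm_num)
    _ = 16 / u := by ring

lemma abs_smoothSgn_sub_sgn_le (u : ℝ) : |smoothSgn u - sgn u| ≤ 1 := by
  rcases le_or_gt 0 u with h | h
  · simpa [sgn, h] using abs_smoothSgn_sub_one_le h
  · have h1 := abs_smoothSgn_sub_one_le (u := -u) (by linarith)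
    rw [smoothSgn_neg, ← abs_neg] at h1
    simp only [sgn, not_le.2 h, if_false]
    convert h1 using 2; ring

lemma abs_smoothSgn_sub_sgn_le_div {u : ℝ} (hu : u ≠ 0) : |smoothSgn u - sgn u| ≤ 16 / |u| := by
  rcases lt_or_gt_of_ne hu with h | h
  · have h1 := abs_smoothSgn_sub_one_le_div (u := -u) (by linarith)
    rw [smoothSgn_neg, ← abs_neg] at h1
    simp only [sgn, not_le.2 h, if_false, abs_of_neg h]
    convert h1 using 2; ring
  · simpa [sgn, h.le, abs_of_pos h] using abs_smoothSgn_sub_one_le_div h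

/-- Polynomial approximation of `smoothSgn`. -/
def sgnPoly (m : ℕ) : Polynomial ℝ :=
  ∑ j ∈ Finset.range m, Polynomial.monomial (2 * j + 1)
    (fejerMass⁻¹ * (2 * (-1) ^ j / ((2 * j + 2).factorial * (2 * j + 1))))

lemma natDegree_sgnPoly_le (m : ℕ) : (sgnPoly m).natDegree ≤ 2 * m := by
  refine Polynomial.natDegree_sum_le_of_forall_le _ _ fun j hj => ?_
  refine (Polynomial.natDegree_monomial_le _).trans ?_
  have := Finset.mem_range.1 hj
  omega

lemma eval_sgnPoly (m : ℕ) (u : ℝ) : (sgnPoly m).eval u = ∑ j ∈ Finset.range m,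
    fejerMass⁻¹ * (2 * (-1) ^ j / ((2 * j + 2).factorial * (2 * j + 1))) * u ^ (2 * j + 1) := by
  simp [sgnPoly, Polynomial.eval_finsetSum]

/-- All coefficients are at most `4`. This crude bound serves only to pay for the total variation
distance. -/
lemma abs_eval_sgnPoly_le (m : ℕ) {u W : ℝ} (hW : 1 ≤ W) (hu : |u| ≤ W) :
    |(sgnPoly m).eval u| ≤ 4 * m * W ^ (2 * m) := by
  rw [eval_sgnPoly]
  refine (Finset.abs_sum_le_sum_abs _ _).trans ?_
  refine (Finset.sum_le_card_nsmul _ _ (4 * W ^ (2 * m)) fun j hj => ?_).trans (by simp; linarith)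
  have hj := Finset.mem_range.1 hj
  rw [abs_mul, abs_mul, abs_pow, abs_of_pos (inv_pos.2 fejerMass_pos)]
  have h1 : |(2 * (-1) ^ j / ((2 * j + 2).factorial * (2 * j + 1)) : ℝ)| ≤ 1 := by
    rw [abs_div, abs_mul, abs_pow, abs_neg, abs_one, one_pow, mul_one,
      abs_of_pos (by positivity : (0 : ℝ) < (2 * j + 2).factorial * (2 * j + 1)),
      div_le_one (by positivity), abs_of_pos two_pos]
    have h2 : (2 : ℝ) ≤ (2 * j + 2).factorial := by
      have := Nat.self_le_factorial (2 * j + 2)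
      exact_mod_cast (by omega : 2 ≤ (2 * j + 2).factorial)
    have h3 : (0 : ℝ) ≤ j := by positivity
    nlinarith
  have h4 : |u| ^ (2 * j + 1) ≤ W ^ (2 * m) :=
    (pow_le_pow_left₀ (abs_nonneg u) hu _).trans (pow_le_pow_right₀ hW (by omega))
  calc fejerMass⁻¹ * _ * |u| ^ (2 * j + 1) ≤ 4 * 1 * W ^ (2 * m) := by
        gcongr
        exact fejerMass_inv_le
    _ = 4 * W ^ (2 * m) := by ring

lemma hasDerivAt_sgnPoly (m : ℕ) (u : ℝ) :
    HasDerivAt (fun u => (sgnPoly m).eval u) (fejerMass⁻¹ * fejerTaylor m u) u := by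
  have he : (fun u => (sgnPoly m).eval u) = fun u => ∑ j ∈ Finset.range m,
    fejerMass⁻¹ * (2 * (-1) ^ j / ((2 * j + 2).factorial * (2 * j + 1))) * u ^ (2 * j + 1) :=
    funext (eval_sgnPoly m)
  rw [he, fejerTaylor, Finset.mul_sum]
  refine HasDerivAt.fun_sum fun j _ => ?_
  refine ((hasDerivAt_pow (2 * j + 1) u).const_mul _).congr_deriv ?_
  push_cast
  field_simp

-- Integrates the Taylor error of the kernel; oddness reduces negative `u` to positive `u`.
open Nat in
lemma abs_smoothSgn_sub_sgnPoly_le {m : ℕ} (hm : 0 < m) (u : ℝ) :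
    |smoothSgn u - (sgnPoly m).eval u| ≤ 4 * (|u| ^ (2 * m + 1) / (2 * m + 1)!) := by
  have key : ∀ u : ℝ, 0 ≤ u →
      |smoothSgn u - (sgnPoly m).eval u| ≤ 4 * (u ^ (2 * m + 1) / (2 * m + 1)!) := by
    intro u hu
    have hd : ∀ z, HasDerivAt (fun z => fejerPrim z - fejerMass * (sgnPoly m).eval z)
        (fejer z - fejerTaylor m z) z := by
      intro z
      have h := (hasDerivAt_fejerPrim z).sub ((hasDerivAt_sgnPoly m z).const_mul fejerMass)
      rwa [mul_inv_cancel_left₀ fejerMass_pos.ne'] at h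
    have h := abs_le_pow_div_factorial_of_hasDerivAt hd
      (by simp [fejerPrim_zero, eval_sgnPoly])
      (fun z _ => abs_fejer_sub_fejerTaylor_le hm z) hu
    have h2 : smoothSgn u - (sgnPoly m).eval u =
        fejerMass⁻¹ * (fejerPrim u - fejerMass * (sgnPoly m).eval u) := by
      rw [smoothSgn, mul_sub, inv_mul_cancel_left₀ fejerMass_pos.ne']
    rw [h2, abs_mul, abs_of_pos (inv_pos.2 fejerMass_pos)]
    exact mul_le_mul fejerMass_inv_le h (abs_nonneg _) (by norm_num)
  rcases le_total 0 u with h | h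
  · simpa [abs_of_nonneg h] using key u h
  · have h1 := key (-u) (by linarith)
    have h2 : (sgnPoly m).eval (-u) = -(sgnPoly m).eval u := by
      rw [eval_sgnPoly, eval_sgnPoly, ← Finset.sum_neg_distrib]
      refine Finset.sum_congr rfl fun j _ => ?_
      rw [(odd_two_mul_add_one j).neg_pow, mul_neg]
    rw [h2, smoothSgn_neg, ← abs_neg] at h1
    rw [abs_of_nonpos h]
    convert h1 using 2; ring

/-! ### Averages over the cube -/

variable {n : ℕ}

lemma toReal_sq (x : Cube n) (i : Fin n) : toReal x i * toReal x i = 1 := by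
  rcases Int.units_eq_one_or (x i) with h | h <;> simp [toReal, h]

lemma toReal_eq_or (x : Cube n) (i : Fin n) : toReal x i = 1 ∨ toReal x i = -1 := by
  rcases Int.units_eq_one_or (x i) with h | h <;> simp [toReal, h]

lemma abs_toReal (x : Cube n) (i : Fin n) : |toReal x i| = 1 := by
  rcases toReal_eq_or x i with h | h <;> simp [h]

/-- Flipping the sign of one coordinate. -/
def flip (i : Fin n) (x : Cube n) : Cube n := x * Pi.mulSingle i (-1)

lemma flip_same (i : Fin n) (x : Cube n) : flip i x i = -x i := by simp [flip]

lemma flip_of_ne {i j : Fin n} (h : j ≠ i) (x : Cube n) : flip i x j = x j := by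
  simp [flip, h]

lemma toReal_flip_same (i : Fin n) (x : Cube n) : toReal (flip i x) i = -toReal x i := by
  simp [toReal, flip_same]

lemma toReal_flip_of_ne {i j : Fin n} (h : j ≠ i) (x : Cube n) :
    toReal (flip i x) j = toReal x j := by
  simp [toReal, flip_of_ne h]

/-- The average of a function over the cube. -/
def cubeAvg (f : Cube n → ℝ) : ℝ := (2 ^ n)⁻¹ * ∑ x, f x

lemma card_cube : Fintype.card (Cube n) = 2 ^ n := by simp [Cube]

lemma cubeAvg_flip (i : Fin n) (f : Cube n → ℝ) : cubeAvg (fun x => f (flip i x)) = cubeAvg f := by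
  unfold cubeAvg flip
  rw [Equiv.sum_comp (Equiv.mulRight (Pi.mulSingle i (-1 : ℤˣ))) f |>.symm]
  rfl

lemma cubeAvg_add (f g : Cube n → ℝ) :
    cubeAvg (fun x => f x + g x) = cubeAvg f + cubeAvg g := by
  simp [cubeAvg, Finset.sum_add_distrib, mul_add]

lemma cubeAvg_const_mul (c : ℝ) (f : Cube n → ℝ) :
    cubeAvg (fun x => c * f x) = c * cubeAvg f := by
  simp only [cubeAvg, ← Finset.mul_sum]; ring

lemma cubeAvg_sum {ι : Type*} (s : Finset ι) (f : ι → Cube n → ℝ) :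
    cubeAvg (fun x => ∑ i ∈ s, f i x) = ∑ i ∈ s, cubeAvg (f i) := by
  simp only [cubeAvg, Finset.mul_sum]
  exact Finset.sum_comm

lemma cubeAvg_const (c : ℝ) : cubeAvg (fun _ : Cube n => c) = c := by
  simp [cubeAvg]

lemma cubeAvg_mono {f g : Cube n → ℝ} (h : ∀ x, f x ≤ g x) : cubeAvg f ≤ cubeAvg g :=
  mul_le_mul_of_nonneg_left (Finset.sum_le_sum fun x _ => h x) (by positivity)

lemma cubeAvg_eq_zero_of_flip_neg (i : Fin n) {f : Cube n → ℝ} (h : ∀ x, f (flip i x) = -f x) :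
    cubeAvg f = 0 := by
  have h1 := cubeAvg_flip i f
  simp only [h] at h1
  have h2 := cubeAvg_const_mul (-1) f
  simp only [neg_one_mul] at h2
  linarith

lemma sum_cube_prod {R : Type*} [CommSemiring R] (F : Fin n → ℤˣ → R) :
    ∑ x : Cube n, ∏ i, F i (x i) = ∏ i, (F i 1 + F i (-1)) := by
  have h := Finset.prod_univ_sum (fun _ : Fin n => (Finset.univ : Finset ℤˣ)) F
  rw [Fintype.piFinset_univ] at h
  rw [← h]
  refine Finset.prod_congr rfl fun i _ => ?_
  rw [show (Finset.univ : Finset ℤˣ) = {1, -1} from rfl, Finset.sum_pair (by decide)]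

/-- A linear form on the cube. -/
def linForm (a : Fin n → ℝ) (x : Cube n) : ℝ := ∑ i, a i * toReal x i

lemma cubeAvg_exp (a : Fin n → ℝ) (l : ℝ) :
    cubeAvg (fun x => Real.exp (l * linForm a x)) = ∏ i, Real.cosh (l * a i) := by
  have h : ∀ x : Cube n, Real.exp (l * linForm a x) =
      ∏ i, (fun i (u : ℤˣ) => Real.exp (l * (a i * ((u : ℤ) : ℝ)))) i (x i) := by
    intro x
    rw [linForm, Finset.mul_sum, Real.exp_sum]
    rfl
  rw [cubeAvg, Finset.sum_congr rfl fun x _ => h x,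
    sum_cube_prod fun i (u : ℤˣ) => Real.exp (l * (a i * ((u : ℤ) : ℝ))), show ((2 : ℝ) ^ n)⁻¹ = ∏ _i : Fin n, (2 : ℝ)⁻¹ by simp,
    ← Finset.prod_mul_distrib]
  refine Finset.prod_congr rfl fun i _ => ?_
  simp [Real.cosh_eq]
  ring

lemma cubeAvg_exp_le (a : Fin n → ℝ) (ha : ∑ i, a i ^ 2 = 1) (l : ℝ) :
    cubeAvg (fun x => Real.exp (l * linForm a x)) ≤ Real.exp (l ^ 2 / 2) := by
  rw [cubeAvg_exp]
  calc ∏ i, Real.cosh (l * a i) ≤ ∏ i, Real.exp ((l * a i) ^ 2 / 2) :=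
        Finset.prod_le_prod (fun i _ => (Real.cosh_pos _).le)
          (fun i _ => Real.cosh_le_exp_half_sq _)
    _ = Real.exp (l ^ 2 / 2) := by
        rw [← Real.exp_sum, ← Finset.sum_div]
        simp only [mul_pow, ← Finset.mul_sum, ha, mul_one]

/-- The real part of the product formula for the characteristic function of a sum of independent
signs. -/
lemma cubeAvg_cos (a : Fin n → ℝ) (φ : ℝ) :
    cubeAvg (fun x => Real.cos (linForm a x + φ)) = Real.cos φ * ∏ i, Real.cos (a i) := by
  have h : ∀ x : Cube n, Complex.exp ((linForm a x + φ : ℝ) * Complex.I) =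
      Complex.exp (φ * Complex.I) *
        ∏ i, (fun i (u : ℤˣ) => Complex.exp (a i * ((u : ℤ) : ℂ) * Complex.I)) i (x i) := by
    intro x
    rw [← Complex.exp_sum, ← Complex.exp_add, linForm]
    congr 1
    push_cast
    rw [add_mul, Finset.sum_mul, add_comm]
    simp [toReal]
  have h2 : ∑ x : Cube n, Complex.exp ((linForm a x + φ : ℝ) * Complex.I) =
      Complex.exp (φ * Complex.I) * ((∏ i, (2 * Real.cos (a i)) : ℝ) : ℂ) := by
    rw [Finset.sum_congr rfl fun x _ => h x, ← Finset.mul_sum,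
      sum_cube_prod fun i (u : ℤˣ) => Complex.exp (a i * ((u : ℤ) : ℂ) * Complex.I)]
    congr 1
    push_cast
    refine Finset.prod_congr rfl fun i _ => ?_
    simp [Complex.two_cos]
  have h3 := congrArg Complex.re h2
  rw [Complex.re_sum, Complex.re_mul_ofReal] at h3
  simp only [Complex.exp_ofReal_mul_I_re] at h3
  rw [cubeAvg, h3, Finset.prod_mul_distrib]
  simp
  field_simp

lemma cubeAvg_linForm_sq (a : Fin n → ℝ) :
    cubeAvg (fun x => linForm a x ^ 2) = ∑ i, a i ^ 2 := by
  have h : ∀ x : Cube n, linForm a x ^ 2 =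
      ∑ i, ∑ j, (a i * a j) * (toReal x i * toReal x j) := by
    intro x
    rw [sq, linForm, Finset.sum_mul_sum]
    exact Finset.sum_congr rfl fun i _ => Finset.sum_congr rfl fun j _ => by ring
  simp only [h, cubeAvg_sum, cubeAvg_const_mul]
  refine Finset.sum_congr rfl fun i _ => ?_
  rw [Finset.sum_eq_single i]
  · simp [toReal_sq, cubeAvg_const, sq]
  · intro j _ hj
    rw [cubeAvg_eq_zero_of_flip_neg i, mul_zero]
    intro x
    rw [toReal_flip_same, toReal_flip_of_ne hj]; ring
  · simp

/-! ### Anti-concentration of regular linear forms -/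

/-- **Esseen's inequality**: linear forms with small coefficients are anti-concentrated. -/
lemma cubeAvg_fejer_le {a : Fin n → ℝ} (ha : ∑ i, a i ^ 2 = 1) {ε : ℝ} (hε : 0 < ε)
    (hreg : ∀ i, |a i| ≤ ε) (θ : ℝ) :
    cubeAvg (fun x => fejer ((linForm a x - θ) / ε)) ≤ 12 * ε := by
  -- From `cos u ≤ 1 - 2 u² / π² ≤ exp (-2 u² / π²)` at `u = s a_i / ε`; since the `a_i²` sum to
  -- `1`, the product over `i` is at most `exp (-b s²)`.
  set b : ℝ := 2 / (Real.pi ^ 2 * ε ^ 2) with hb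
  have hb0 : 0 < b := by positivity
  have hcos : ∀ s ∈ Set.Icc (0 : ℝ) 1,
      (1 - s) * cubeAvg (fun x => Real.cos (s * ((linForm a x - θ) / ε))) ≤
        Real.exp (-b * s ^ 2) := by
    intro s hs
    have h1 : ∀ x : Cube n, s * ((linForm a x - θ) / ε) =
        linForm (fun i => s * a i / ε) x + -(s * θ / ε) := by
      intro x
      have : linForm (fun i => s * a i / ε) x = s / ε * linForm a x := by
        rw [linForm, linForm, Finset.mul_sum]
        exact Finset.sum_congr rfl fun i _ => by ring
      rw [this]; ring
    simp only [h1, cubeAvg_cos]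
    have h2 : ∏ i, |Real.cos (s * a i / ε)| ≤ Real.exp (-b * s ^ 2) := by
      calc ∏ i, |Real.cos (s * a i / ε)|
          ≤ ∏ i, Real.exp (-b * s ^ 2 * a i ^ 2) := by
            refine Finset.prod_le_prod (fun i _ => abs_nonneg _) fun i _ => ?_
            -- Regularity enters here: it keeps the argument in the range where the cosine is
            -- nonnegative and the quadratic bound holds.
            have h3 : |s * a i / ε| ≤ 1 := by
              rw [abs_div, abs_mul, abs_of_pos hε, abs_of_nonneg hs.1, div_le_one hε]
              have := mul_le_mul hs.2 (hreg i) (abs_nonneg _) zero_le_one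
              linarith
            have hpi := Real.pi_gt_three
            have h3' := abs_le.1 h3
            rw [abs_of_nonneg (Real.cos_nonneg_of_mem_Icc ⟨by linarith, by linarith⟩)]
            have h4 := Real.cos_le_one_sub_mul_cos_sq (x := s * a i / ε) (by linarith)
            have h5 := Real.add_one_le_exp (-b * s ^ 2 * a i ^ 2)
            have h6 : -b * s ^ 2 * a i ^ 2 = -(2 / Real.pi ^ 2 * (s * a i / ε) ^ 2) := by
              rw [hb]; field_simp
            linarith
        _ = Real.exp (-b * s ^ 2) := by
            rw [← Real.exp_sum, ← Finset.mul_sum, ha, mul_one]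
    calc (1 - s) * (Real.cos (-(s * θ / ε)) * ∏ i, Real.cos (s * a i / ε))
        ≤ |(1 - s) * (Real.cos (-(s * θ / ε)) * ∏ i, Real.cos (s * a i / ε))| := le_abs_self _
      _ = (1 - s) * (|Real.cos (-(s * θ / ε))| * ∏ i, |Real.cos (s * a i / ε)|) := by
          rw [abs_mul, abs_mul, Finset.abs_prod, abs_of_nonneg (by linarith [hs.2])]
      _ ≤ 1 * (1 * Real.exp (-b * s ^ 2)) := by
          have := Real.abs_cos_le_one (-(s * θ / ε))
          gcongr
          · linarith [hs.1]
      _ = _ := by ring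
  have hint : cubeAvg (fun x => fejer ((linForm a x - θ) / ε)) = 2 * ∫ s in (0 : ℝ)..1,
      (1 - s) * cubeAvg (fun x => Real.cos (s * ((linForm a x - θ) / ε))) := by
    have h1 : ∀ s : ℝ, (1 - s) * cubeAvg (fun x => Real.cos (s * ((linForm a x - θ) / ε))) =
        (2 ^ n)⁻¹ * ∑ x : Cube n, (1 - s) * Real.cos (s * ((linForm a x - θ) / ε)) := by
      intro s
      rw [cubeAvg, ← Finset.mul_sum]; ring
    simp only [h1]
    rw [intervalIntegral.integral_const_mul, intervalIntegral.integral_finsetSum]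
    · simp only [cubeAvg, fejer, ← Finset.mul_sum]; ring
    · intro x _
      exact (by fun_prop : Continuous fun s : ℝ =>
        (1 - s) * Real.cos (s * ((linForm a x - θ) / ε))).intervalIntegrable _ _
  have hle : ∫ s in (0 : ℝ)..1, (1 - s) *
      cubeAvg (fun x => Real.cos (s * ((linForm a x - θ) / ε))) ≤
      ∫ s in (0 : ℝ)..1, Real.exp (-b * s ^ 2) := by
    refine intervalIntegral.integral_mono_on zero_le_one ?_ ?_ hcos
    · refine Continuous.intervalIntegrable ?_ _ _
      unfold cubeAvg
      fun_prop
    · exact (by fun_prop : Continuous fun s : ℝ => Real.exp (-b * s ^ 2)).intervalIntegrable _ _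
  have hle2 : ∫ s in (0 : ℝ)..1, Real.exp (-b * s ^ 2) ≤ √(Real.pi / b) := by
    rw [intervalIntegral.integral_of_le zero_le_one, ← integral_gaussian]
    exact MeasureTheory.setIntegral_le_integral (integrable_exp_neg_mul_sq hb0)
      (Filter.Eventually.of_forall fun s => (Real.exp_pos _).le)
  have hle3 : √(Real.pi / b) ≤ 6 * ε := by
    rw [Real.sqrt_le_left (by positivity)]
    have h : Real.pi / b = Real.pi ^ 3 / 2 * ε ^ 2 := by rw [hb]; field_simp
    rw [h]
    have hpi4 := Real.pi_le_four
    have : Real.pi ^ 3 ≤ 4 ^ 3 := by gcongr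
    nlinarith [sq_nonneg ε]
  rw [hint]
  linarith

/-! ### Conditioning on a set of coordinates; `k`-wise independence -/

/-- The kernel `2 ^ |H|` times the indicator of agreement on `H`. -/
def agreeKer (H : Finset (Fin n)) (x y : Cube n) : ℝ := ∏ i ∈ H, (1 + toReal x i * toReal y i)

lemma agreeKer_nonneg (H : Finset (Fin n)) (x y : Cube n) : 0 ≤ agreeKer H x y := by
  refine Finset.prod_nonneg fun i _ => ?_
  rcases toReal_eq_or x i with h | h <;> rcases toReal_eq_or y i with h' | h' <;> simp [h, h']

lemma agreeKer_comm (H : Finset (Fin n)) (x y : Cube n) : agreeKer H x y = agreeKer H y x := by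
  simp only [agreeKer, mul_comm]

lemma toReal_eq_of_agreeKer_ne_zero {H : Finset (Fin n)} {x y : Cube n} (h : agreeKer H x y ≠ 0)
    {i : Fin n} (hi : i ∈ H) : toReal x i = toReal y i := by
  have h1 := Finset.prod_ne_zero_iff.1 h i hi
  rcases toReal_eq_or x i with h | h <;> rcases toReal_eq_or y i with h' | h' <;>
    simp [h, h'] at h1 ⊢

/-- In the factor `1 + x_i y_i` the second term is odd in coordinate `i`, on which nothing else
depends, so it averages to zero. -/
lemma cubeAvg_agreeKer_mul (H : Finset (Fin n)) (y : Cube n) {Q : Cube n → ℝ}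
    (hQ : ∀ i ∈ H, ∀ x, Q (flip i x) = Q x) :
    cubeAvg (fun x => agreeKer H x y * Q x) = cubeAvg Q := by
  induction H using Finset.induction_on with
  | empty => simp [agreeKer]
  | insert i H hi ih =>
    have h1 : ∀ x, agreeKer (insert i H) x y * Q x =
        agreeKer H x y * Q x + toReal x i * toReal y i * (agreeKer H x y * Q x) := by
      intro x; rw [agreeKer, Finset.prod_insert hi, agreeKer]; ring
    simp only [h1]
    rw [cubeAvg_add, ih fun j hj => hQ j (Finset.mem_insert_of_mem hj),
      cubeAvg_eq_zero_of_flip_neg (f := fun x => toReal x i * toReal y i * _) i, add_zero]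
    intro x
    have h2 : agreeKer H (flip i x) y = agreeKer H x y := by
      refine Finset.prod_congr rfl fun j hj => ?_
      rw [toReal_flip_of_ne (ne_of_mem_of_not_mem hj hi)]
    rw [h2, hQ i (Finset.mem_insert_self _ _), toReal_flip_same]
    ring

lemma cubeAvg_agreeKer (H : Finset (Fin n)) (x : Cube n) :
    cubeAvg (fun y => agreeKer H x y) = 1 := by
  have h := cubeAvg_agreeKer_mul H x (Q := fun _ => 1) (fun _ _ _ => rfl)
  simp only [mul_one, cubeAvg_const] at h
  simpa only [agreeKer_comm H x] using h

lemma linForm_flip {a : Fin n → ℝ} {i : Fin n} (hi : a i = 0) (x : Cube n) :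
    linForm a (flip i x) = linForm a x := by
  refine Finset.sum_congr rfl fun j _ => ?_
  rcases eq_or_ne j i with rfl | h
  · simp [hi]
  · rw [toReal_flip_of_ne h]

lemma sum_toReal_map {Ω Ω' : Type*} [Fintype Ω] [Fintype Ω'] (D : PMF Ω) (r : Ω → Ω')
    (F : Ω' → ℝ) : ∑ x, (D x).toReal * F (r x) = ∑ b, ((D.map r) b).toReal * F b := by
  classical
  have h : ∀ b, ((D.map r) b).toReal = ∑ x, if b = r x then (D x).toReal else 0 := by
    intro b
    rw [PMF.map_apply, tsum_fintype, ENNReal.toReal_sum]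
    · refine Finset.sum_congr rfl fun x _ => ?_
      split_ifs <;> simp
    · intro x _
      split_ifs
      · exact D.apply_ne_top x
      · simp
  simp only [h, Finset.sum_mul]
  rw [Finset.sum_comm]
  refine Finset.sum_congr rfl fun x _ => ?_
  simp [ite_mul]

lemma cubeAvg_restrict (S : Finset (Fin n)) (F : (S → ℤˣ) → ℝ) :
    cubeAvg (fun x : Cube n => F fun i => x i) =
      ∑ b, (PMF.uniformOfFintype (S → ℤˣ) b).toReal * F b := by
  classical
  have h1 : ∑ x : Cube n, F (fun i : S => x i) = 2 ^ (n - S.card) * ∑ b, F b := by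
    rw [← Equiv.sum_comp (Equiv.piEquivPiSubtypeProd (fun i => i ∈ S) (fun _ => ℤˣ)).symm,
      Fintype.sum_prod_type, Finset.mul_sum]
    refine Finset.sum_congr rfl fun b _ => ?_
    have : ∀ c : {i // i ∉ S} → ℤˣ, (fun i : S =>
        (Equiv.piEquivPiSubtypeProd (fun i => i ∈ S) (fun _ => ℤˣ)).symm (b, c) i) = b := by
      intro c; funext i; simp [Equiv.piEquivPiSubtypeProd]
    simp only [this]
    simp [Fintype.card_subtype_compl]
  have hS : S.card ≤ n := by simpa using S.card_le_univ
  simp only [PMF.uniformOfFintype_apply, ← Finset.mul_sum]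
  rw [cubeAvg, h1, ← mul_assoc]
  congr 1
  simp
  rw [← pow_sub_mul_pow 2 hS]
  field_simp

/-- Distributions that are `k`-wise independent have the same expectations of `k`-juntas as the
uniform distribution. -/
lemma KWiseIndependent.expect_eq_cubeAvg {k : ℕ} {D : PMF (Cube n)} (hD : KWiseIndependent k D)
    {S : Finset (Fin n)} (hS : S.card ≤ k) {f : Cube n → ℝ} (hf : DependsOn f S) :
    expect D f = cubeAvg f := by
  classical
  -- The value `1` off `S` is arbitrary, as `f` does not see those coordinates.
  let F : (S → ℤˣ) → ℝ := fun b => f fun i => if h : i ∈ S then b ⟨i, h⟩ else 1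
  have hF : f = fun x => F fun i => x i := by
    funext x
    refine hf fun i hi => ?_
    simp [Finset.mem_coe.1 hi]
  rw [hF, cubeAvg_restrict, expect, sum_toReal_map D (fun (x : Cube n) (i : S) => x i) F, hD S hS]

lemma expect_sum {Ω ι : Type*} [Fintype Ω] (D : PMF Ω) (s : Finset ι) (f : ι → Ω → ℝ) :
    expect D (fun x => ∑ i ∈ s, f i x) = ∑ i ∈ s, expect D (f i) := by
  simp only [expect, Finset.mul_sum]
  exact Finset.sum_comm

lemma expect_const_mul {Ω : Type*} [Fintype Ω] (D : PMF Ω) (c : ℝ) (f : Ω → ℝ) :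
    expect D (fun x => c * f x) = c * expect D f := by
  simp only [expect, Finset.mul_sum]
  exact Finset.sum_congr rfl fun i _ => by ring

lemma expect_add {Ω : Type*} [Fintype Ω] (D : PMF Ω) (f g : Ω → ℝ) :
    expect D (fun x => f x + g x) = expect D f + expect D g := by
  simp only [expect, mul_add, Finset.sum_add_distrib]

lemma expect_mono {Ω : Type*} [Fintype Ω] (D : PMF Ω) {f g : Ω → ℝ} (h : ∀ x, f x ≤ g x) :
    expect D f ≤ expect D g :=
  Finset.sum_le_sum fun x _ => mul_le_mul_of_nonneg_left (h x) ENNReal.toReal_nonneg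

lemma expect_const {Ω : Type*} [Fintype Ω] (D : PMF Ω) (c : ℝ) : expect D (fun _ => c) = c := by
  have h : ∑ x, (D x).toReal = 1 := by
    rw [← ENNReal.toReal_sum fun x _ => D.apply_ne_top x, ← tsum_fintype (L := .unconditional _),
      D.tsum_coe, ENNReal.toReal_one]
  rw [expect, ← Finset.sum_mul, h, one_mul]

lemma expect_cubeAvg {Ω : Type*} [Fintype Ω] (D : PMF Ω) (f : Ω → Cube n → ℝ) :
    expect D (fun x => cubeAvg (f x)) = cubeAvg fun y => expect D fun x => f x y := by
  simp only [cubeAvg, expect_const_mul, expect_sum]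

/-- Induction on the power: expanding one factor of the linear form moves a coordinate into the
junta `g`, whose support grows by at most one. -/
lemma KWiseIndependent.expect_mul_linForm_pow {k : ℕ} {D : PMF (Cube n)}
    (hD : KWiseIndependent k D) (a : Fin n → ℝ) (j : ℕ) :
    ∀ {S : Finset (Fin n)} {g : Cube n → ℝ}, DependsOn g S → S.card + j ≤ k →
      expect D (fun x => g x * linForm a x ^ j) = cubeAvg (fun x => g x * linForm a x ^ j) := by
  classical
  induction j with
  | zero =>
    intro S g hg hS
    simpa using hD.expect_eq_cubeAvg hS hg
  | succ j ih =>
    intro S g hg hS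
    have h : ∀ x, g x * linForm a x ^ (j + 1) =
        ∑ i, a i * ((g x * toReal x i) * linForm a x ^ j) := by
      intro x
      rw [pow_succ', ← mul_assoc, linForm, Finset.mul_sum, Finset.sum_mul]
      exact Finset.sum_congr rfl fun i _ => by ring
    simp only [h, expect_sum, cubeAvg_sum, expect_const_mul, cubeAvg_const_mul]
    refine Finset.sum_congr rfl fun i _ => ?_
    rw [ih (S := insert i S)]
    · intro x y hxy
      have h1 : g x = g y := hg fun l hl => hxy l (by simp [Finset.mem_coe.1 hl])
      have h2 : x i = y i := hxy i (by simp)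
      simp [h1, toReal, h2]
    · have := Finset.card_insert_le i S
      omega

/-- The kernel is a junta on `H`, so the uniform distribution may replace `D`; there it averages
out, the form `a` being free of `H`. -/
lemma KWiseIndependent.expect_agreeKer_mul_linForm_pow {k : ℕ} {D : PMF (Cube n)}
    (hD : KWiseIndependent k D) {a : Fin n → ℝ} {H : Finset (Fin n)} (ha : ∀ i ∈ H, a i = 0)
    {j : ℕ} (hj : H.card + j ≤ k) (y : Cube n) :
    expect D (fun x => agreeKer H x y * linForm a x ^ j) =
      cubeAvg (fun x => linForm a x ^ j) := by
  rw [hD.expect_mul_linForm_pow a j (S := H) ?_ hj]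
  · exact cubeAvg_agreeKer_mul H y fun i hi x => by rw [linForm_flip (ha i hi)]
  · intro x x' h
    refine Finset.prod_congr rfl fun i hi => ?_
    simp [toReal, h i (Finset.mem_coe.2 hi)]

lemma abs_expect_sub_le {Ω : Type*} [Fintype Ω] (D D' : PMF Ω) {f : Ω → ℝ} {B : ℝ}
    (hf : ∀ x, |f x| ≤ B) : expect D f ≤ expect D' f + 2 * tvDist D D' * B := by
  have h : expect D f - expect D' f ≤ 2 * tvDist D D' * B := by
    rw [expect, expect, tvDist, ← Finset.sum_sub_distrib,
      show 2 * ((1 / 2) * ∑ x, |(D x).toReal - (D' x).toReal|) * B =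
        ∑ x, |(D x).toReal - (D' x).toReal| * B by rw [← Finset.sum_mul]; ring]
    refine Finset.sum_le_sum fun x _ => ?_
    rw [← sub_mul]
    refine (le_abs_self _).trans ?_
    rw [abs_mul]
    exact mul_le_mul_of_nonneg_left (hf x) (abs_nonneg _)
  linarith

/-! ### Moment matching and the regular case -/

/-- `w` is a nonnegative weight under which the linear form `a` has the same moments up to order
`K` as under the uniform distribution. -/
structure MatchesMoments (w : Cube n → ℝ) (a : Fin n → ℝ) (K : ℕ) : Prop where
  nonneg : ∀ x, 0 ≤ w x
  moment : ∀ j ≤ K, ∑ x, w x * linForm a x ^ j = cubeAvg fun x => linForm a x ^ j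

lemma MatchesMoments.eval {w : Cube n → ℝ} {a : Fin n → ℝ} {K : ℕ} (h : MatchesMoments w a K)
    {q : Polynomial ℝ} (hq : q.natDegree ≤ K) :
    ∑ x, w x * q.eval (linForm a x) = cubeAvg fun x => q.eval (linForm a x) := by
  simp only [Polynomial.eval_eq_sum_range' (Nat.lt_succ_of_le hq)]
  rw [cubeAvg_sum]
  simp only [cubeAvg_const_mul, Finset.mul_sum]
  rw [Finset.sum_comm]
  refine Finset.sum_congr rfl fun j hj => ?_
  rw [← h.moment j (Nat.lt_succ_iff.1 (Finset.mem_range.1 hj)), Finset.mul_sum]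
  exact Finset.sum_congr rfl fun x _ => by ring

lemma MatchesMoments.pow {w : Cube n → ℝ} {a : Fin n → ℝ} {K : ℕ} (h : MatchesMoments w a K)
    {j : ℕ} (hj : j ≤ K) (θ δ : ℝ) :
    ∑ x, w x * ((linForm a x - θ) / δ) ^ j = cubeAvg fun x => ((linForm a x - θ) / δ) ^ j := by
  have hq : ((Polynomial.C δ⁻¹ * (Polynomial.X - Polynomial.C θ)) ^ j).natDegree ≤ K := by
    refine Polynomial.natDegree_pow_le.trans ?_
    have h1 : (Polynomial.C δ⁻¹ * (Polynomial.X - Polynomial.C θ)).natDegree ≤ 1 :=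
      (Polynomial.natDegree_C_mul_le _ _).trans (Polynomial.natDegree_X_sub_C_le _)
    exact (Nat.mul_le_mul_left j h1).trans (by omega)
  have h2 := h.eval hq
  simpa [div_eq_inv_mul] using h2

lemma MatchesMoments.fejerTaylor {w : Cube n → ℝ} {a : Fin n → ℝ} {K m : ℕ}
    (h : MatchesMoments w a K) (hm : 2 * m ≤ K) (θ δ : ℝ) :
    ∑ x, w x * fejerTaylor m ((linForm a x - θ) / δ) =
      cubeAvg fun x => fejerTaylor m ((linForm a x - θ) / δ) := by
  have h1 : ∀ y, HalfspaceApprox.fejerTaylor m y = ∑ j ∈ Finset.range m,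
      (2 * (-1) ^ j / ((2 * j + 2).factorial : ℝ)) * y ^ (2 * j) :=
    fun y => Finset.sum_congr rfl fun j _ => by ring
  simp only [h1, cubeAvg_sum, cubeAvg_const_mul, Finset.mul_sum]
  rw [Finset.sum_comm]
  refine Finset.sum_congr rfl fun j hj => ?_
  have := Finset.mem_range.1 hj
  rw [← h.pow (by omega) θ δ, Finset.mul_sum]
  exact Finset.sum_congr rfl fun x _ => by ring

/-- Shifted even moments of a linear form are small compared with the factorial. -/
lemma cubeAvg_pow_div_factorial_le {a : Fin n → ℝ} (ha : ∑ i, a i ^ 2 = 1) (θ : ℝ) {δ : ℝ}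
    (hδ : 0 < δ) (m : ℕ) :
    cubeAvg (fun x => ((linForm a x - θ) / δ) ^ (2 * m) / (2 * m).factorial) ≤
      2 * Real.exp (8 / δ ^ 2 + θ ^ 2 / 2 - 2 * m) := by
  -- The factor `e` produces the gain `exp (-2m)`: with `z = l (X - θ)`, the `2m`-th power of `(X -
  -- θ) / δ` is `exp (-2m) z ^ (2m)`, and `|z| ^ (2m) / (2m)! ≤ exp |z|`.
  set l : ℝ := Real.exp 1 / δ with hl
  have hl0 : 0 < l := by positivity
  have h1 : ∀ x : Cube n, ((linForm a x - θ) / δ) ^ (2 * m) / (2 * m).factorial ≤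
      Real.exp (-(2 * m)) * (Real.exp (-(l * θ)) * Real.exp (l * linForm a x) +
        Real.exp (l * θ) * Real.exp (-l * linForm a x)) := by
    intro x
    set z : ℝ := l * (linForm a x - θ) with hz
    have h2 : ((linForm a x - θ) / δ) ^ (2 * m) = Real.exp (-(2 * m)) * |z| ^ (2 * m) := by
      rw [(even_two_mul m).pow_abs, hz, hl, div_mul_eq_mul_div, mul_div_assoc, mul_pow,
        ← mul_assoc, ← Real.exp_nat_mul, ← Real.exp_add]
      push_cast
      simp
    have h3 := Real.pow_div_factorial_le_exp |z| (abs_nonneg z) (2 * m)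
    have h4 : Real.exp |z| ≤ Real.exp z + Real.exp (-z) := by
      rcases abs_cases z with ⟨h, _⟩ | ⟨h, _⟩ <;> rw [h] <;>
        linarith [Real.exp_pos z, Real.exp_pos (-z)]
    rw [h2, mul_div_assoc, ← Real.exp_add, ← Real.exp_add]
    refine mul_le_mul_of_nonneg_left ?_ (Real.exp_pos _).le
    convert h3.trans h4 using 3 <;> rw [hz] <;> ring
  refine (cubeAvg_mono h1).trans ?_
  rw [cubeAvg_const_mul, cubeAvg_add, cubeAvg_const_mul, cubeAvg_const_mul]
  have h5 := cubeAvg_exp_le a ha l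
  have h6 := cubeAvg_exp_le a ha (-l)
  rw [neg_sq] at h6
  have he : Real.exp 1 ^ 2 ≤ 8 := by
    have := Real.exp_one_lt_d9
    have := Real.exp_pos 1
    nlinarith
  have hl2 : l ^ 2 ≤ 8 / δ ^ 2 := by
    rw [hl, div_pow]; gcongr
  have key : ∀ t : ℝ, t ^ 2 = θ ^ 2 → Real.exp (-(2 * m)) * (Real.exp (l * t) *
      Real.exp (l ^ 2 / 2)) ≤ Real.exp (8 / δ ^ 2 + θ ^ 2 / 2 - 2 * m) := by
    intro t ht
    rw [← Real.exp_add, ← Real.exp_add]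
    refine Real.exp_le_exp.2 ?_
    nlinarith [sq_nonneg (l - t)]
  have k1 := key θ rfl
  have k2 := key (-θ) (neg_sq θ)
  rw [mul_neg] at k2
  calc _ ≤ Real.exp (-(2 * m)) * (Real.exp (-(l * θ)) * Real.exp (l ^ 2 / 2) +
        Real.exp (l * θ) * Real.exp (l ^ 2 / 2)) := by gcongr
    _ ≤ _ := by rw [mul_add]; linarith

-- The Taylor remainder has odd order, and an odd power of `|u|` is not a polynomial. It is
-- dominated by its even neighbours, whose moments can be matched; which one wins depends on whether
-- `|u|` exceeds `2m + 1`.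
open Nat in
lemma abs_pow_succ_div_factorial_le (m : ℕ) (u : ℝ) :
    |u| ^ (2 * m + 1) / (2 * m + 1)! ≤
      u ^ (2 * m) / (2 * m)! + 2 * (u ^ (2 * (m + 1)) / (2 * (m + 1))!) := by
  rw [← (even_two_mul m).pow_abs, ← (even_two_mul (m + 1)).pow_abs u]
  have h0 := abs_nonneg u
  set v := |u|
  rcases le_total v (2 * m + 1) with h | h
  · have : v ^ (2 * m + 1) / (2 * m + 1)! ≤ v ^ (2 * m) / (2 * m)! := by
      rw [Nat.factorial_succ, pow_succ, div_le_div_iff₀ (by positivity) (by positivity)]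
      push_cast
      have h2 : 0 ≤ v ^ (2 * m) * ((2 * m)! : ℝ) := by positivity
      nlinarith
    have : 0 ≤ v ^ (2 * (m + 1)) / ((2 * (m + 1))! : ℝ) := by positivity
    linarith
  · have : v ^ (2 * m + 1) / (2 * m + 1)! ≤ 2 * (v ^ (2 * (m + 1)) / (2 * (m + 1))!) := by
      rw [Nat.mul_add, mul_one, Nat.factorial_succ (2 * m + 1), pow_succ v (2 * m + 1),
        ← mul_div_assoc, div_le_div_iff₀ (by positivity) (by positivity)]
      push_cast
      have h2 : 0 ≤ v ^ (2 * m + 1) * ((2 * m + 1)! : ℝ) := by positivity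
      have h3 : (0 : ℝ) ≤ m := by positivity
      nlinarith
    have : 0 ≤ v ^ (2 * m) / ((2 * m)! : ℝ) := by positivity
    linarith

/-- For `|t| ≤ ε` the error is at most `1`, and the Fejér term is at least that; beyond `ε` the
decay `16 / |u|` gives the first term. -/
lemma abs_smoothSgn_sub_sgn_le_fejer {ε δ : ℝ} (hε : 0 < ε) (hδ : 0 < δ) (t : ℝ) :
    |smoothSgn (t / δ) - sgn t| ≤ 16 * (δ / ε) + 4 * fejer (t / ε) := by
  have hs : sgn (t / δ) = sgn t := by simp [sgn, div_nonneg_iff, hδ.le, hδ.not_ge]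
  rw [← hs]
  have hf := fejer_nonneg (t / ε)
  rcases le_or_gt |t| ε with h | h
  · have h1 := fejer_ge (y := t / ε) (by rwa [abs_div, abs_of_pos hε, div_le_one hε])
    have h2 := abs_smoothSgn_sub_sgn_le (t / δ)
    have : 0 < δ / ε := by positivity
    linarith
  · have ht : t ≠ 0 := abs_pos.1 (hε.trans h)
    have h1 := abs_smoothSgn_sub_sgn_le_div (div_ne_zero ht hδ.ne')
    have h2 : 16 / |t / δ| ≤ 16 * (δ / ε) := by
      rw [abs_div, abs_of_pos hδ, ← mul_div_assoc, div_div_eq_mul_div]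
      gcongr
    linarith

/-- The budget is `16ε` for smoothing away from the threshold, `4 · 16ε` near it, and `4 · 2ε + 8 ·
2ε` for the Taylor remainder. The remainder involves the power `2(m + 1)`, whence moments up to `2m
+ 2`. -/
lemma sum_abs_sgnPoly_sub_sgn_le {a : Fin n → ℝ} (ha : ∑ i, a i ^ 2 = 1) {ε : ℝ} (hε : 0 < ε)
    (hε1 : ε ≤ 1) (hreg : ∀ i, |a i| ≤ ε) {θ : ℝ} (hθ : θ ^ 2 ≤ 1 / ε) {m : ℕ}
    (hm : 9 / ε ^ 4 ≤ m) {w : Cube n → ℝ} (hw : MatchesMoments w a (2 * m + 2)) :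
    ∑ x, w x * |(sgnPoly m).eval ((linForm a x - θ) / ε ^ 2) - sgn (linForm a x - θ)| ≤
      104 * ε := by
  have hm0 : 0 < m := by
    have : (0 : ℝ) < m := lt_of_lt_of_le (by positivity) hm
    exact_mod_cast this
  have hδ : 0 < ε ^ 2 := by positivity
  have hinv : 1 / ε ≤ 1 / ε ^ 4 :=
    one_div_le_one_div_of_le (by positivity) (pow_le_of_le_one hε.le hε1 (by norm_num))
  -- At `δ = ε²` the exponent is at most `8/ε⁴ + 1/(2ε) - 18/ε⁴`, hence at most `-1/ε`, and `exp
  -- (-1/ε) ≤ ε`.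
  have hexp : ∀ M : ℕ, m ≤ M →
      2 * Real.exp (8 / (ε ^ 2) ^ 2 + θ ^ 2 / 2 - 2 * M) ≤ 2 * ε := by
    intro M hM
    have hM' : (m : ℝ) ≤ M := by exact_mod_cast hM
    have h1 : 8 / (ε ^ 2) ^ 2 + θ ^ 2 / 2 - 2 * M ≤ -(1 / ε) := by
      rw [← pow_mul]
      have h2 : 8 / ε ^ (2 * 2) = 8 * (1 / ε ^ 4) := by ring
      have h3 : 9 / ε ^ 4 = 9 * (1 / ε ^ 4) := by ring
      have h4 : 0 < 1 / ε := by positivity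
      rw [h2]
      linarith
    have h2 := Real.add_one_le_exp (1 / ε)
    have h3 : Real.exp (-(1 / ε)) ≤ ε := by
      rw [Real.exp_neg]
      refine inv_le_of_inv_le₀ hε ?_
      rw [← one_div]; linarith
    linarith [Real.exp_le_exp.2 h1]
  set U : Cube n → ℝ := fun x => (linForm a x - θ) / ε ^ 2 with hU
  have hmom : ∀ M : ℕ, m ≤ M → cubeAvg (fun x => U x ^ (2 * M) / (2 * M).factorial) ≤ 2 * ε :=
    fun M hM => (cubeAvg_pow_div_factorial_le ha θ hδ M).trans (hexp M hM)
  have hmomw : ∀ M : ℕ, m ≤ M → M ≤ m + 1 →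
      ∑ x, w x * (U x ^ (2 * M) / (2 * M).factorial) ≤ 2 * ε := by
    intro M hM hM'
    have h1 := hw.pow (j := 2 * M) (by omega) θ (ε ^ 2)
    have h2 := hmom M hM
    simp only [div_eq_inv_mul _ ((2 * M).factorial : ℝ), cubeAvg_const_mul] at h2
    rw [hU, ← h1, Finset.mul_sum] at h2
    refine le_trans (le_of_eq ?_) h2
    exact Finset.sum_congr rfl fun x _ => by rw [hU]; ring
  have hmass : ∑ x, w x = 1 := by
    have := hw.moment 0 (by omega)
    simpa [cubeAvg_const] using this
  -- The kernel is replaced by its Taylor polynomial, the weight by the uniform one, and the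
  -- polynomial by the kernel again: `2ε + 2ε + 12ε`.
  have hfej : ∑ x, w x * fejer ((linForm a x - θ) / ε) ≤ 16 * ε := by
    have hdiff : ∀ x, |fejer ((linForm a x - θ) / ε) -
        fejerTaylor m ((linForm a x - θ) / ε)| ≤ U x ^ (2 * m) / (2 * m).factorial := by
      intro x
      refine (abs_fejer_sub_fejerTaylor_le hm0 _).trans ?_
      refine div_le_div_of_nonneg_right ?_ (by positivity)
      rw [pow_mul, pow_mul]
      refine pow_le_pow_left₀ (sq_nonneg _) ?_ m
      rw [hU, div_pow, div_pow]
      gcongr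
      exact pow_le_of_le_one hε.le hε1 two_ne_zero
    calc ∑ x, w x * fejer ((linForm a x - θ) / ε)
        ≤ ∑ x, (w x * fejerTaylor m ((linForm a x - θ) / ε) +
            w x * (U x ^ (2 * m) / (2 * m).factorial)) := by
          refine Finset.sum_le_sum fun x _ => ?_
          rw [← mul_add]
          exact mul_le_mul_of_nonneg_left (by linarith [(abs_le.1 (hdiff x)).2]) (hw.nonneg x)
      _ ≤ cubeAvg (fun x => fejerTaylor m ((linForm a x - θ) / ε)) + 2 * ε := by
          rw [Finset.sum_add_distrib, hw.fejerTaylor (by omega)]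
          linarith [hmomw m le_rfl (by omega)]
      _ ≤ cubeAvg (fun x => fejer ((linForm a x - θ) / ε) +
            U x ^ (2 * m) / (2 * m).factorial) + 2 * ε := by
          gcongr
          exact cubeAvg_mono fun x => by linarith [(abs_le.1 (hdiff x)).1]
      _ ≤ 16 * ε := by
          rw [cubeAvg_add]
          linarith [cubeAvg_fejer_le ha hε hreg θ, hmom m le_rfl]
  have hpt : ∀ x, w x * |(sgnPoly m).eval (U x) - sgn (linForm a x - θ)| ≤
      16 * ε * w x + 4 * (w x * fejer ((linForm a x - θ) / ε)) +
        (4 * (w x * (U x ^ (2 * m) / (2 * m).factorial)) +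
          8 * (w x * (U x ^ (2 * (m + 1)) / (2 * (m + 1)).factorial))) := by
    intro x
    have h1 := abs_smoothSgn_sub_sgn_le_fejer hε hδ (linForm a x - θ)
    have h2 := abs_smoothSgn_sub_sgnPoly_le hm0 (U x)
    have h3 := abs_pow_succ_div_factorial_le m (U x)
    have h4 : ε ^ 2 / ε = ε := by field_simp
    rw [h4] at h1
    have h5 := abs_sub_le ((sgnPoly m).eval (U x)) (smoothSgn (U x)) (sgn (linForm a x - θ))
    rw [abs_sub_comm] at h2
    calc _ ≤ w x * (16 * ε + 4 * fejer ((linForm a x - θ) / ε) +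
        4 * (U x ^ (2 * m) / (2 * m).factorial +
          2 * (U x ^ (2 * (m + 1)) / (2 * (m + 1)).factorial))) :=
          mul_le_mul_of_nonneg_left (by linarith) (hw.nonneg x)
      _ = _ := by ring
  refine (Finset.sum_le_sum fun x _ => hpt x).trans ?_
  simp only [Finset.sum_add_distrib, ← Finset.mul_sum]
  rw [hmass]
  linarith [hmomw m le_rfl (by omega), hmomw (m + 1) (by omega) le_rfl]

lemma abs_sgn (t : ℝ) : |sgn t| = 1 := by
  unfold sgn; split_ifs <;> simp

/-- The signs can differ only if `X² ≥ θ² ≥ 1/ε`. This is Chebyshev's inequality in pointwise form,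
ready for matching second moments. -/
lemma abs_sgn_neg_sub_sgn_le {X θ ε : ℝ} (hε : 0 < ε) (hθ : 1 / ε ≤ θ ^ 2) :
    |sgn (-θ) - sgn (X - θ)| ≤ 2 * ε * X ^ 2 := by
  by_cases h : sgn (-θ) = sgn (X - θ)
  · rw [h, sub_self, abs_zero]; positivity
  · have h1 : θ ^ 2 ≤ X ^ 2 := by
      rw [sq_le_sq]
      unfold sgn at h
      split_ifs at h with h2 h3 h3
      · simp at h
      · rw [abs_of_nonpos (by linarith : θ ≤ 0)]
        exact le_trans (by linarith) (neg_le_abs X)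
      · rw [abs_of_pos (by linarith : 0 < θ)]
        exact le_trans (by linarith) (le_abs_self X)
      · simp at h
    have h2 : |sgn (-θ) - sgn (X - θ)| ≤ 2 := by
      have := abs_sub (sgn (-θ)) (sgn (X - θ))
      rw [abs_sgn, abs_sgn] at this
      linarith
    have h3 : 1 ≤ ε * X ^ 2 := by
      have := mul_le_mul_of_nonneg_left (hθ.trans h1) hε.le
      rwa [mul_one_div_cancel hε.ne'] at this
    linarith

/-- A univariate polynomial approximating the sign of `t - θ` on average for every regular linear
form of variance one whose moments match those of the uniform distribution. -/
lemma exists_polynomial_of_regular {ε : ℝ} (hε : 0 < ε) (hε1 : ε ≤ 1) {m : ℕ}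
    (hm : 9 / ε ^ 4 ≤ m) (θ : ℝ) :
    ∃ p : Polynomial ℝ, p.natDegree ≤ 2 * m ∧
      (∀ T t : ℝ, 1 ≤ T → |t| ≤ T → |p.eval t| ≤ 4 * m * ((T + 1 / ε) / ε ^ 2) ^ (2 * m)) ∧
      ∀ (n : ℕ) (a : Fin n → ℝ), ∑ i, a i ^ 2 = 1 → (∀ i, |a i| ≤ ε) →
        ∀ w : Cube n → ℝ, MatchesMoments w a (2 * m + 2) →
          ∑ x, w x * |p.eval (linForm a x) - sgn (linForm a x - θ)| ≤ 104 * ε := by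
  have hδ : 0 < ε ^ 2 := by positivity
  have hδ1 : ε ^ 2 ≤ 1 := pow_le_one₀ hε.le hε1
  have hm1 : (1 : ℝ) ≤ m := by
    have h1 : 1 ≤ 1 / ε ^ 4 := by
      rw [le_div_iff₀ (by positivity), one_mul]; exact pow_le_one₀ hε.le hε1
    have h2 : 9 / ε ^ 4 = 9 * (1 / ε ^ 4) := by ring
    linarith
  have hW : ∀ T : ℝ, 1 ≤ T → 1 ≤ (T + 1 / ε) / ε ^ 2 := by
    intro T hT
    rw [le_div_iff₀ hδ, one_mul]
    have : 0 < 1 / ε := by positivity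
    linarith
  rcases le_total (θ ^ 2) (1 / ε) with h | h
  · refine ⟨(sgnPoly m).comp (Polynomial.C (ε ^ 2)⁻¹ * (Polynomial.X - Polynomial.C θ)),
      ?_, ?_, ?_⟩
    · refine Polynomial.natDegree_comp_le.trans ?_
      have h1 : (Polynomial.C (ε ^ 2)⁻¹ * (Polynomial.X - Polynomial.C θ)).natDegree ≤ 1 :=
        (Polynomial.natDegree_C_mul_le _ _).trans (Polynomial.natDegree_X_sub_C_le _)
      calc _ ≤ 2 * m * 1 := Nat.mul_le_mul (natDegree_sgnPoly_le m) h1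
        _ = 2 * m := mul_one _
    · intro T t hT ht
      rw [Polynomial.eval_comp]
      refine abs_eval_sgnPoly_le m (hW T hT) ?_
      simp only [Polynomial.eval_mul, Polynomial.eval_C, Polynomial.eval_sub, Polynomial.eval_X]
      rw [← div_eq_inv_mul, abs_div, abs_of_pos hδ]
      have hθ : |θ| ≤ 1 / ε := by
        refine abs_le_of_sq_le_sq (h.trans ?_) (by positivity)
        rw [div_pow, one_pow]
        exact one_div_le_one_div_of_le hδ (pow_le_of_le_one hε.le hε1 two_ne_zero)
      gcongr
      exact (abs_sub _ _).trans (add_le_add ht hθ)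
    · intro n a ha hreg w hw
      have := sum_abs_sgnPoly_sub_sgn_le ha hε hε1 hreg h hm hw
      simpa [Polynomial.eval_comp, div_eq_inv_mul] using this
  · refine ⟨Polynomial.C (sgn (-θ)), by simp, ?_, ?_⟩
    · intro T t hT _
      rw [Polynomial.eval_C, abs_sgn]
      have := one_le_pow₀ (hW T hT) (n := 2 * m)
      nlinarith
    · intro n a ha _ w hw
      simp only [Polynomial.eval_C]
      calc _ ≤ ∑ x, 2 * ε * (w x * linForm a x ^ 2) := by
            refine Finset.sum_le_sum fun x _ => ?_
            have := mul_le_mul_of_nonneg_left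
              (abs_sgn_neg_sub_sgn_le (X := linForm a x) hε h) (hw.nonneg x)
            linarith
        _ = 2 * ε := by
            rw [← Finset.mul_sum, hw.moment 2 (by omega), cubeAvg_linForm_sq, ha, mul_one]
        _ ≤ 104 * ε := by linarith

/-! ### Heavy coordinates: regularity or separation -/

/-- The part of the linear form `v` outside `H`, in squared norm. -/
def tailVar (v : Fin n → ℝ) (H : Finset (Fin n)) : ℝ := ∑ i ∈ Hᶜ, v i ^ 2

/-- The restriction of `v` to `H`. -/
def headPart (v : Fin n → ℝ) (H : Finset (Fin n)) : Fin n → ℝ := fun i => if i ∈ H then v i else 0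

/-- The restriction of `v` to the complement of `H`. -/
def tailPart (v : Fin n → ℝ) (H : Finset (Fin n)) : Fin n → ℝ := fun i => if i ∈ H then 0 else v i

/-- No coordinate outside `H` has more than a `τ` fraction of the norm outside `H`. -/
def RegularOutside (τ : ℝ) (v : Fin n → ℝ) (H : Finset (Fin n)) : Prop :=
  ∀ i, i ∉ H → v i ^ 2 ≤ τ ^ 2 * tailVar v H

lemma linForm_eq_head_add_tail (v : Fin n → ℝ) (H : Finset (Fin n)) (x : Cube n) :
    linForm v x = linForm (headPart v H) x + linForm (tailPart v H) x := by
  rw [linForm, linForm, linForm, ← Finset.sum_add_distrib]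
  refine Finset.sum_congr rfl fun i _ => ?_
  by_cases h : i ∈ H <;> simp [headPart, tailPart, h]

lemma sum_tailPart_sq (v : Fin n → ℝ) (H : Finset (Fin n)) :
    ∑ i, tailPart v H i ^ 2 = tailVar v H := by
  rw [tailVar, ← Finset.sum_subset (Finset.subset_univ Hᶜ)]
  · refine Finset.sum_congr rfl fun i hi => ?_
    simp [tailPart, Finset.mem_compl.1 hi]
  · intro i _ hi
    simp [tailPart, by simpa using hi]

lemma tailVar_nonneg (v : Fin n → ℝ) (H : Finset (Fin n)) : 0 ≤ tailVar v H :=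
  Finset.sum_nonneg fun _ _ => sq_nonneg _

lemma sq_le_tailVar (v : Fin n → ℝ) {H : Finset (Fin n)} {i : Fin n} (hi : i ∉ H) :
    v i ^ 2 ≤ tailVar v H :=
  Finset.single_le_sum (f := fun i => v i ^ 2) (fun _ _ => sq_nonneg _) (Finset.mem_compl.2 hi)

lemma tailVar_insert (v : Fin n → ℝ) {H : Finset (Fin n)} {i : Fin n} (hi : i ∉ H) :
    tailVar v (insert i H) = tailVar v H - v i ^ 2 := by
  rw [tailVar, tailVar, Finset.compl_insert, eq_sub_iff_add_eq,
    Finset.sum_erase_add _ _ (Finset.mem_compl.2 hi)]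

/-- Greedy: as long as regularity fails, moving an offending coordinate into the set multiplies the
tail variance by at most `1 - τ²`. -/
lemma exists_regularOutside_or_tailVar_le (v : Fin n → ℝ) {τ : ℝ} (hτ : τ ^ 2 ≤ 1) (g : ℕ)
    (H : Finset (Fin n)) : ∃ H', H ⊆ H' ∧ H'.card ≤ H.card + g ∧
      (RegularOutside τ v H' ∨ tailVar v H' ≤ (1 - τ ^ 2) ^ g * tailVar v H) := by
  induction g with
  | zero => exact ⟨H, subset_rfl, by simp, Or.inr (by simp)⟩
  | succ g ih =>
    obtain ⟨H', hHH', hc, h⟩ := ih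
    by_cases hr : RegularOutside τ v H'
    · exact ⟨H', hHH', by omega, Or.inl hr⟩
    · have h1 := h.resolve_left hr
      simp only [RegularOutside, not_forall, not_le] at hr
      obtain ⟨i, hi, hlt⟩ := hr
      refine ⟨insert i H', hHH'.trans (Finset.subset_insert _ _), ?_, Or.inr ?_⟩
      · rw [Finset.card_insert_of_notMem hi]; omega
      · rw [tailVar_insert v hi, pow_succ' (1 - τ ^ 2)]
        have := mul_le_mul_of_nonneg_left h1 (by linarith : 0 ≤ 1 - τ ^ 2)
        linarith

/-- Changing signs inside `J` changes the value of the linear form `v` by at least `ρ`. -/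
def Separates (v : Fin n → ℝ) (J : Finset (Fin n)) (ρ : ℝ) : Prop :=
  ∀ x x' : Cube n, (∀ i, i ∉ J → x i = x' i) → x ≠ x' → ρ ≤ |linForm v x - linForm v x'|

lemma linForm_sub_linForm_of_eq_off {v : Fin n → ℝ} {i : Fin n} {x x' : Cube n}
    (h : ∀ j, j ≠ i → x j = x' j) :
    linForm v x - linForm v x' = v i * (toReal x i - toReal x' i) := by
  rw [linForm, linForm, ← Finset.sum_sub_distrib, Finset.sum_eq_single i]
  · ring
  · intro j _ hj
    simp [toReal, h j hj]
  · simp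

/-- Changing coordinate `i` moves the form by at most `2 |v i|`, so a gap of `3 |v i|` created
inside `J` leaves at least `|v i|`. -/
lemma Separates.insert {v : Fin n → ℝ} {J : Finset (Fin n)} {ρ : ℝ} (h : Separates v J ρ)
    {i : Fin n} (hi : i ∉ J) (hv : 3 * |v i| ≤ ρ) : Separates v (insert i J) |v i| := by
  intro x x' hxx' hne
  set z : Cube n := Function.update x i (x' i) with hz
  have hzi : z i = x' i := by simp [hz]
  have hzj : ∀ j, j ≠ i → x j = z j := fun j hj => by simp [hz, hj]
  have h1 := linForm_sub_linForm_of_eq_off (v := v) hzj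
  have h0 := abs_nonneg (v i)
  by_cases hzx : z = x'
  · have hxi : x i ≠ x' i := by
      intro he
      apply hne
      rw [← hzx, hz, ← he, Function.update_eq_self]
    rw [hzx] at h1
    rw [h1, abs_mul]
    have h2 : 1 ≤ |toReal x i - toReal x' i| := by
      rcases Int.units_eq_one_or (x i) with h3 | h3 <;>
        rcases Int.units_eq_one_or (x' i) with h4 | h4 <;>
        first
          | exact absurd (h3.trans h4.symm) hxi
          | (simp [toReal, h3, h4]; norm_num)
    nlinarith
  · have h2 := h z x' (fun j hj => by
      rcases eq_or_ne j i with rfl | hji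
      · exact hzi
      · rw [← hzj j hji]
        exact hxx' j (by simp [hji, hj])) hzx
    have h3 : |toReal x i - toReal z i| ≤ 2 := by
      refine (abs_sub _ _).trans ?_
      rw [abs_toReal, abs_toReal]; norm_num
    have h4 : |linForm v x - linForm v z| ≤ 2 * |v i| := by
      rw [h1, abs_mul]; nlinarith
    have h5 := abs_sub_abs_le_abs_sub (linForm v z - linForm v x') (linForm v z - linForm v x)
    rw [sub_sub_sub_cancel_left, abs_sub_comm (linForm v z) (linForm v x)] at h5
    linarith

/-- Either the linear form is regular outside a small set of coordinates, or a small set of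
coordinates contains many coordinates of fast decreasing weight and carries most of the norm. -/
lemma exists_regularOutside_or_separates {v : Fin n → ℝ} (hv : ∑ i, v i ^ 2 = 1) {τ : ℝ}
    (hτ : 0 < τ) (hτ3 : 3 * τ ≤ 1) {g : ℕ} (hg : (1 - τ ^ 2) ^ g ≤ τ ^ 4) (M : ℕ) :
    ∃ H : Finset (Fin n), H.card ≤ M * (g + 1) ∧ (RegularOutside τ v H ∨
      ∃ J ⊆ H, J.card = M ∧ ∃ ρ > 0, tailVar v H ≤ τ ^ 2 * ρ ^ 2 ∧ Separates v J ρ) := by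
  have hτ1 : τ ^ 2 ≤ 1 := by nlinarith
  induction M with
  | zero =>
    -- The empty set separates vacuously at any scale; `ρ = 1/τ` makes `τ² ρ²` equal to the whole
    -- variance `1`.
    refine ⟨∅, by simp, Or.inr ⟨∅, subset_rfl, rfl, 1 / τ, by positivity, ?_, ?_⟩⟩
    · rw [tailVar, Finset.compl_empty, hv, div_pow, one_pow, mul_one_div_cancel (by positivity)]
    · intro x x' h hne
      exact absurd (funext fun i => h i (by simp)) hne
  | succ M ih =>
    obtain ⟨H, hc, h⟩ := ih
    by_cases hr : RegularOutside τ v H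
    · exact ⟨H, hc.trans (Nat.mul_le_mul_right _ (by omega)), Or.inl hr⟩
    · obtain ⟨J, hJH, hJ, ρ, hρ, htail, hsep⟩ := h.resolve_left hr
      simp only [RegularOutside, not_forall, not_le] at hr
      obtain ⟨i, hi, hlt⟩ := hr
      -- The irregular coordinate `i` becomes the next separating one. If `g` further greedy moves
      -- do not reach regularity, the tail falls to `τ⁴` times its old value, below `τ² |v i|²`,
      -- which restores the invariant with `ρ = |v i|`.
      obtain ⟨H', hHH', hc', h'⟩ := exists_regularOutside_or_tailVar_le v hτ1 g (insert i H)
      rw [Finset.card_insert_of_notMem hi] at hc'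
      have hcard : H'.card ≤ (M + 1) * (g + 1) := by rw [Nat.succ_mul]; omega
      refine ⟨H', hcard, h'.imp_right fun h2 => ?_⟩
      have hiJ : i ∉ J := fun h => hi (hJH h)
      have hpos : 0 < v i ^ 2 := lt_of_le_of_lt (mul_nonneg (sq_nonneg _) (tailVar_nonneg v H)) hlt
      refine ⟨insert i J, (Finset.insert_subset_insert i hJH).trans hHH', ?_, |v i|, ?_, ?_,
        hsep.insert hiJ ?_⟩
      · rw [Finset.card_insert_of_notMem hiJ, hJ]
      · exact abs_pos.2 (by rintro h0; simp [h0] at hpos)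
      · rw [sq_abs]
        rw [tailVar_insert v hi] at h2
        have h3 : (1 - τ ^ 2) ^ g * (tailVar v H - v i ^ 2) ≤ τ ^ 4 * tailVar v H := by
          have h4 : tailVar v H - v i ^ 2 ≤ tailVar v H := by linarith
          have h5 : 0 ≤ tailVar v H - v i ^ 2 := by linarith [sq_le_tailVar v hi]
          exact mul_le_mul hg h4 h5 (by positivity)
        have h6 := mul_le_mul_of_nonneg_left hlt.le (sq_nonneg τ)
        calc _ ≤ τ ^ 4 * tailVar v H := h2.trans h3
          _ = τ ^ 2 * (τ ^ 2 * tailVar v H) := by ring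
          _ ≤ _ := h6
      · have h3 : |v i| ≤ τ * ρ := by
          refine abs_le_of_sq_le_sq ?_ (by positivity)
          rw [mul_pow]
          exact (sq_le_tailVar v hi).trans htail
        nlinarith

lemma Separates.headPart {v : Fin n → ℝ} {J H : Finset (Fin n)} {ρ : ℝ} (h : Separates v J ρ)
    (hJ : J ⊆ H) : Separates (headPart v H) J ρ := by
  intro x x' hxx' hne
  have h1 := h x x' hxx' hne
  have h2 : linForm (tailPart v H) x = linForm (tailPart v H) x' := by
    refine Finset.sum_congr rfl fun i _ => ?_
    by_cases hi : i ∈ H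
    · simp [tailPart, hi]
    · simp [toReal, hxx' i fun hiJ => hi (hJ hiJ)]
  rwa [linForm_eq_head_add_tail v H x, linForm_eq_head_add_tail v H x', h2,
    add_sub_add_right_eq_sub] at h1

/-! ### Replacing the halfspace by its head -/

/-- Small-ball estimate for linear forms that separate the points of a subcube. -/
lemma Separates.cubeAvg_le {v : Fin n → ℝ} {J : Finset (Fin n)} {ρ r : ℝ}
    (h : Separates v J ρ) (hr : 2 * r < ρ) (θ : ℝ) :
    cubeAvg (fun x => if |linForm v x - θ| ≤ r then 1 else 0) ≤ (2 ^ J.card)⁻¹ := by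
  classical
  set B : Finset (Cube n) := Finset.univ.filter fun x => |linForm v x - θ| ≤ r with hB
  -- Flipping subsets of `J` maps `B × 𝒫(J)` injectively into the cube: points of `B` that agree off
  -- `J` have values within `2r < ρ`, so they coincide.
  let s : Finset (Fin n) → Cube n := fun S i => if i ∈ S then -1 else 1
  have hs : Function.Injective s := by
    intro S S' hSS'
    ext i
    have := congrFun hSS' i
    by_cases h1 : i ∈ S <;> by_cases h2 : i ∈ S' <;> simp [s, h1, h2] at this ⊢
  have hcard : B.card * 2 ^ J.card ≤ 2 ^ n := by
    rw [← Finset.card_powerset, ← Finset.card_product, ← card_cube, ← Finset.card_univ]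
    refine Finset.card_le_card_of_injOn (fun p => p.1 * s p.2) (fun _ _ => Finset.mem_coe.2
      (Finset.mem_univ _)) ?_
    rintro ⟨x, S⟩ hx ⟨x', S'⟩ hx' he
    simp only [Finset.coe_product, Set.mem_prod, Finset.mem_coe, Finset.mem_powerset, hB,
      Finset.mem_filter, Finset.mem_univ, true_and] at hx hx' he
    have hxx' : x = x' := by
      by_contra hne
      have h1 := h x x' (fun i hi => by
        have h2 := congrFun he i
        have h3 : i ∉ S := fun h => hi (hx.2 h)
        have h4 : i ∉ S' := fun h => hi (hx'.2 h)
        simpa [s, h3, h4] using h2) hne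
      have h2 := abs_sub_le (linForm v x) θ (linForm v x')
      rw [abs_sub_comm θ] at h2
      linarith [hx.1, hx'.1]
    subst hxx'
    exact Prod.ext rfl (hs (mul_left_cancel he))
  have hsum : ∑ x : Cube n, (if |linForm v x - θ| ≤ r then (1 : ℝ) else 0) = B.card := by
    rw [Finset.sum_boole]
  rw [cubeAvg, hsum, inv_mul_le_iff₀ (by positivity), ← div_eq_mul_inv,
    le_div_iff₀ (by positivity)]
  exact_mod_cast hcard

/-- A perturbation `t` changes the sign only if `u` is within `r` of zero or `|t| ≥ r`; the
quadratic term pays for the latter. -/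
lemma abs_sgn_sub_sgn_add_le {u t r : ℝ} (hr : 0 < r) :
    |sgn u - sgn (u + t)| ≤ 2 * (if |u| ≤ r then 1 else 0) + 2 / r ^ 2 * t ^ 2 := by
  have h2 : |sgn u - sgn (u + t)| ≤ 2 := by
    have := abs_sub (sgn u) (sgn (u + t))
    rw [abs_sgn, abs_sgn] at this
    linarith
  have h3 : 0 ≤ 2 / r ^ 2 * t ^ 2 := by positivity
  split_ifs with hu
  · linarith
  · rw [not_le] at hu
    rcases le_or_gt r |t| with ht | ht
    · have : 2 ≤ 2 / r ^ 2 * t ^ 2 := by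
        rw [div_mul_eq_mul_div, le_div_iff₀ (by positivity), ← sq_abs t]
        nlinarith
      linarith
    · have : sgn u = sgn (u + t) := by
        have ht' := abs_lt.1 ht
        rcases le_or_gt 0 u with h | h
        · rw [abs_of_nonneg h] at hu
          simp only [sgn, h, if_true]
          rw [if_pos (by linarith)]
        · rw [abs_of_neg h] at hu
          simp only [sgn, not_le.2 h, if_false]
          rw [if_neg (by linarith)]
      rw [this, sub_self, abs_zero]
      linarith

lemma KWiseIndependent.expect_linForm_sq {k : ℕ} {D : PMF (Cube n)}
    (hD : KWiseIndependent k D) (hk : 2 ≤ k) (a : Fin n → ℝ) :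
    expect D (fun x => linForm a x ^ 2) = ∑ i, a i ^ 2 := by
  have h := hD.expect_mul_linForm_pow a 2 (S := ∅) (g := fun _ => 1) (fun _ _ _ => rfl)
    (by simpa using hk)
  simpa [cubeAvg_linForm_sq] using h

lemma dependsOn_linForm_headPart (v : Fin n → ℝ) (H : Finset (Fin n)) (F : ℝ → ℝ) :
    DependsOn (fun x : Cube n => F (linForm (headPart v H) x)) (H : Set (Fin n)) := by
  intro x y h
  have : linForm (headPart v H) x = linForm (headPart v H) y := by
    refine Finset.sum_congr rfl fun i _ => ?_
    by_cases hi : i ∈ H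
    · simp [toReal, h i (Finset.mem_coe.2 hi)]
    · simp [headPart, hi]
  simp only [this]

/-- The small-ball event depends on `H` only and the tail enters by its second moment, so `k`-wise
independence suffices for both. The radius `ρ / 3` meets `2r < ρ`. -/
lemma expect_abs_sgn_headPart_sub_le {v : Fin n → ℝ} {H J : Finset (Fin n)} {ρ τ : ℝ}
    (hρ : 0 < ρ) (hJ : J ⊆ H) (hsep : Separates v J ρ) (htail : tailVar v H ≤ τ ^ 2 * ρ ^ 2)
    {k : ℕ} (hk : H.card ≤ k) (hk2 : 2 ≤ k) {D : PMF (Cube n)} (hD : KWiseIndependent k D)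
    (θ : ℝ) :
    expect D (fun x => |sgn (linForm (headPart v H) x - θ) - sgn (linForm v x - θ)|) ≤
      2 * (2 ^ J.card)⁻¹ + 18 * τ ^ 2 := by
  have hr : 0 < ρ / 3 := by positivity
  calc _ ≤ expect D (fun x => 2 * (if |linForm (headPart v H) x - θ| ≤ ρ / 3 then 1 else 0) +
        2 / (ρ / 3) ^ 2 * linForm (tailPart v H) x ^ 2) := by
        refine expect_mono D fun x => ?_
        have := abs_sgn_sub_sgn_add_le (u := linForm (headPart v H) x - θ)
          (t := linForm (tailPart v H) x) hr
        rwa [sub_add_eq_add_sub, ← linForm_eq_head_add_tail] at this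
    _ = 2 * cubeAvg (fun x => if |linForm (headPart v H) x - θ| ≤ ρ / 3 then 1 else 0) +
        2 / (ρ / 3) ^ 2 * tailVar v H := by
        rw [expect_add, expect_const_mul, expect_const_mul, hD.expect_linForm_sq hk2,
          sum_tailPart_sq, hD.expect_eq_cubeAvg hk
            (dependsOn_linForm_headPart v H fun t => if |t - θ| ≤ ρ / 3 then 1 else 0)]
    _ ≤ 2 * (2 ^ J.card)⁻¹ + 2 / (ρ / 3) ^ 2 * (τ ^ 2 * ρ ^ 2) := by
        gcongr
        exact (hsep.headPart hJ).cubeAvg_le (by linarith) θ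
    _ = _ := by field_simp; ring

/-! ### Gluing univariate polynomials over the values on `H` -/

/-- The polynomial that evaluates, at a point `x`, the univariate polynomial `q x` at the linear
form `a`, provided that `q` depends on the coordinates in `H` only. -/
def blend (H : Finset (Fin n)) (a : Fin n → ℝ) (q : Cube n → Polynomial ℝ) :
    MvPolynomial (Fin n) ℝ :=
  ((2 : ℝ) ^ n)⁻¹ • ∑ y, (∏ i ∈ H, (1 + toReal y i • MvPolynomial.X i)) *
    Polynomial.aeval (∑ i, a i • MvPolynomial.X i : MvPolynomial (Fin n) ℝ) (q y)

lemma eval_blend (H : Finset (Fin n)) (a : Fin n → ℝ) (q : Cube n → Polynomial ℝ) (x : Cube n) :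
    MvPolynomial.eval (toReal x) (blend H a q) =
      cubeAvg fun y => agreeKer H x y * (q y).eval (linForm a x) := by
  rw [blend, MvPolynomial.smul_eval, cubeAvg, map_sum]
  congr 1
  refine Finset.sum_congr rfl fun y _ => ?_
  rw [map_mul, map_prod, agreeKer]
  congr 1
  · refine Finset.prod_congr rfl fun i _ => ?_
    simp [MvPolynomial.smul_eval, mul_comm]
  · rw [Polynomial.aeval_def, Polynomial.hom_eval₂]
    have h1 : (MvPolynomial.eval (toReal x)).comp (algebraMap ℝ (MvPolynomial (Fin n) ℝ)) =
        RingHom.id ℝ := by ext; simp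
    rw [h1, Polynomial.eval₂_id]
    simp [linForm, MvPolynomial.smul_eval]

lemma totalDegree_aeval_le (L : MvPolynomial (Fin n) ℝ) (hL : L.totalDegree ≤ 1)
    (p : Polynomial ℝ) : (Polynomial.aeval L p).totalDegree ≤ p.natDegree := by
  rw [Polynomial.aeval_eq_sum_range]
  refine MvPolynomial.totalDegree_finsetSum_le fun i hi => ?_
  refine (MvPolynomial.totalDegree_smul_le _ _).trans ((MvPolynomial.totalDegree_pow _ _).trans ?_)
  have := Finset.mem_range.1 hi
  calc i * L.totalDegree ≤ i * 1 := Nat.mul_le_mul_left _ hL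
    _ ≤ p.natDegree := by omega

lemma totalDegree_blend_le (H : Finset (Fin n)) (a : Fin n → ℝ) {q : Cube n → Polynomial ℝ}
    {d : ℕ} (hq : ∀ y, (q y).natDegree ≤ d) : (blend H a q).totalDegree ≤ H.card + d := by
  refine (MvPolynomial.totalDegree_smul_le _ _).trans ?_
  refine MvPolynomial.totalDegree_finsetSum_le fun y _ => ?_
  refine (MvPolynomial.totalDegree_mul _ _).trans (add_le_add ?_ ?_)
  · refine (MvPolynomial.totalDegree_finsetProd _ _).trans ?_
    refine (Finset.sum_le_card_nsmul _ _ 1 fun i _ => ?_).trans (by simp)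
    refine (MvPolynomial.totalDegree_add _ _).trans (max_le (by simp) ?_)
    exact (MvPolynomial.totalDegree_smul_le _ _).trans (by simp)
  · refine (totalDegree_aeval_le _ ?_ _).trans (hq y)
    refine MvPolynomial.totalDegree_finsetSum_le fun i _ => ?_
    exact (MvPolynomial.totalDegree_smul_le _ _).trans (by simp)

/-- Jensen's inequality: the kernel is a probability density in `y` relative to the uniform measure.
-/
lemma abs_cubeAvg_agreeKer_mul_sub_le (H : Finset (Fin n)) (x : Cube n) (F : Cube n → ℝ) (c : ℝ) :
    |cubeAvg (fun y => agreeKer H x y * F y) - c| ≤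
      cubeAvg fun y => agreeKer H x y * |F y - c| := by
  have h1 : cubeAvg (fun y => agreeKer H x y * F y) - c =
      cubeAvg fun y => agreeKer H x y * (F y - c) := by
    have h2 : ∀ y, agreeKer H x y * F y = agreeKer H x y * (F y - c) + c * agreeKer H x y :=
      fun y => by ring
    simp only [h2]
    rw [cubeAvg_add, cubeAvg_const_mul, cubeAvg_agreeKer]; ring
  rw [h1, cubeAvg, abs_mul, abs_of_pos (by positivity : (0 : ℝ) < (2 ^ n)⁻¹)]
  refine mul_le_mul_of_nonneg_left ((Finset.abs_sum_le_sum_abs _ _).trans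
    (Finset.sum_le_sum fun y _ => ?_)) (by positivity)
  rw [abs_mul, abs_of_nonneg (agreeKer_nonneg H x y)]

lemma abs_eval_blend_le {H : Finset (Fin n)} {a : Fin n → ℝ} {q : Cube n → Polynomial ℝ}
    {x : Cube n} {B : ℝ} (hB : ∀ y, |(q y).eval (linForm a x)| ≤ B) :
    |MvPolynomial.eval (toReal x) (blend H a q)| ≤ B := by
  rw [eval_blend]
  have h := abs_cubeAvg_agreeKer_mul_sub_le H x (fun y => (q y).eval (linForm a x)) 0
  simp only [sub_zero] at h
  refine h.trans ?_
  calc _ ≤ cubeAvg fun y => B * agreeKer H x y := cubeAvg_mono fun y => by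
        rw [mul_comm B]; exact mul_le_mul_of_nonneg_left (hB y) (agreeKer_nonneg H x y)
    _ = B := by rw [cubeAvg_const_mul, cubeAvg_agreeKer, mul_one]

lemma linForm_headPart_eq_of_agreeKer_ne_zero {H : Finset (Fin n)} {x y : Cube n}
    (h : agreeKer H x y ≠ 0) (v : Fin n → ℝ) :
    linForm (headPart v H) x = linForm (headPart v H) y := by
  refine Finset.sum_congr rfl fun i _ => ?_
  by_cases hi : i ∈ H
  · rw [toReal_eq_of_agreeKer_ne_zero h hi]
  · simp [headPart, hi]

/-- The polynomial equal to `sgn (v · x - θ)` with `v` restricted to `H`. -/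
def headPoly (v : Fin n → ℝ) (H : Finset (Fin n)) (θ : ℝ) : MvPolynomial (Fin n) ℝ :=
  blend H 0 fun y => Polynomial.C (sgn (linForm (headPart v H) y - θ))

lemma eval_headPoly (v : Fin n → ℝ) (H : Finset (Fin n)) (θ : ℝ) (x : Cube n) :
    MvPolynomial.eval (toReal x) (headPoly v H θ) = sgn (linForm (headPart v H) x - θ) := by
  rw [headPoly, eval_blend, ← sub_eq_zero, ← abs_eq_zero]
  refine le_antisymm ((abs_cubeAvg_agreeKer_mul_sub_le H x _ _).trans (le_of_eq ?_)) (abs_nonneg _)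
  rw [← cubeAvg_const (n := n) 0]
  congr 1
  funext y
  by_cases h : agreeKer H x y = 0
  · simp [h]
  · rw [linForm_headPart_eq_of_agreeKer_ne_zero h]; simp

lemma totalDegree_headPoly_le (v : Fin n → ℝ) (H : Finset (Fin n)) (θ : ℝ) :
    (headPoly v H θ).totalDegree ≤ H.card :=
  totalDegree_blend_le H 0 (d := 0) fun y => by simp

lemma headPart_univ (v : Fin n → ℝ) : headPart v Finset.univ = v := by
  funext i; simp [headPart]

/-- Exchanging the averages over `x` and `y` lets every fixed assignment `y` on `H` be treated
separately, with weight `D(x)` times the kernel. -/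
lemma expect_abs_blend_sub_le {H : Finset (Fin n)} {a : Fin n → ℝ} {q : Cube n → Polynomial ℝ}
    {f : Cube n → ℝ} {D : PMF (Cube n)} {B : ℝ}
    (h : ∀ y, ∑ x, ((D x).toReal * agreeKer H x y) * |(q y).eval (linForm a x) - f x| ≤ B) :
    expect D (fun x => |MvPolynomial.eval (toReal x) (blend H a q) - f x|) ≤ B := by
  calc _ ≤ expect D (fun x => cubeAvg fun y =>
        agreeKer H x y * |(q y).eval (linForm a x) - f x|) := expect_mono D fun x => by
          rw [eval_blend]; exact abs_cubeAvg_agreeKer_mul_sub_le H x _ _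
    _ = cubeAvg fun y => expect D fun x => agreeKer H x y * |(q y).eval (linForm a x) - f x| :=
        expect_cubeAvg D _
    _ ≤ cubeAvg fun _ : Cube n => B := cubeAvg_mono fun y => by
        simpa only [expect, mul_assoc] using h y
    _ = B := cubeAvg_const B

lemma abs_linForm_le {a : Fin n → ℝ} (ha : ∀ i, |a i| ≤ 1) (x : Cube n) : |linForm a x| ≤ n := by
  refine (Finset.abs_sum_le_sum_abs _ _).trans ?_
  refine (Finset.sum_le_card_nsmul _ _ 1 fun i _ => ?_).trans (by simp)
  rw [abs_mul, abs_toReal, mul_one]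
  exact ha i

lemma sgn_div {s : ℝ} (hs : 0 < s) (t : ℝ) : sgn (t / s) = sgn t := by
  simp [sgn, div_nonneg_iff, hs.le, hs.not_ge]

/-! ### Approximation under exact `k`-wise independence -/

/-- Polynomial approximation of a halfspace that is regular outside `H`. -/
lemma exists_approx_of_regularOutside {v : Fin n → ℝ} {H : Finset (Fin n)} {ε : ℝ} (hε : 0 < ε)
    (hε1 : ε ≤ 1) (hreg : RegularOutside ε v H) (hn : 1 ≤ n) {m : ℕ} (hm : 9 / ε ^ 4 ≤ m)
    (θ : ℝ) :
    ∃ P : MvPolynomial (Fin n) ℝ, P.totalDegree ≤ H.card + 2 * m ∧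
      (∀ x : Cube n, |MvPolynomial.eval (toReal x) P| ≤
        1 + 4 * m * ((n + 1 / ε) / ε ^ 2) ^ (2 * m)) ∧
      ∀ (k : ℕ) (D : PMF (Cube n)), H.card + 2 * m + 2 ≤ k → KWiseIndependent k D →
        expect D (fun x => |MvPolynomial.eval (toReal x) P - sgn (linForm v x - θ)|) ≤
          104 * ε := by
  -- A vanishing tail cannot be normalised, but then the halfspace depends on `H` only and
  -- `headPoly` is exact.
  rcases (tailVar_nonneg v H).eq_or_lt with h0 | hpos
  · have hhead : headPart v H = v := by
      funext i
      by_cases hi : i ∈ H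
      · simp [headPart, hi]
      · have h1 := sq_le_tailVar v hi
        rw [← h0] at h1
        have h2 : v i = 0 := pow_eq_zero_iff two_ne_zero |>.1 (le_antisymm h1 (sq_nonneg _))
        simp [headPart, hi, h2]
    refine ⟨headPoly v H θ, (totalDegree_headPoly_le v H θ).trans (by omega), fun x => ?_,
      fun k D _ _ => ?_⟩
    · rw [eval_headPoly, abs_sgn]
      have : 0 ≤ 4 * m * ((n + 1 / ε) / ε ^ 2) ^ (2 * m) := by positivity
      linarith
    · simp only [eval_headPoly, hhead, sub_self, abs_zero, expect_const]
      positivity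
  · set s : ℝ := √(tailVar v H) with hs
    have hs0 : 0 < s := Real.sqrt_pos.2 hpos
    have hs2 : s ^ 2 = tailVar v H := Real.sq_sqrt hpos.le
    set a : Fin n → ℝ := fun i => tailPart v H i / s with ha
    have ha2 : ∑ i, a i ^ 2 = 1 := by
      simp only [ha, div_pow, ← Finset.sum_div]
      rw [sum_tailPart_sq, hs2, div_self hpos.ne']
    have haε : ∀ i, |a i| ≤ ε := by
      intro i
      by_cases hi : i ∈ H
      · simp [ha, tailPart, hi, hε.le]
      · refine abs_le_of_sq_le_sq ?_ hε.le
        simp only [ha, tailPart, hi, if_false]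
        rw [div_pow, div_le_iff₀ (by positivity), hs2]
        exact hreg i hi
    have haH : ∀ i ∈ H, a i = 0 := fun i hi => by simp [ha, tailPart, hi]
    have haX : ∀ x, linForm a x = linForm (tailPart v H) x / s := by
      intro x
      rw [linForm, linForm, Finset.sum_div]
      exact Finset.sum_congr rfl fun i _ => by rw [ha]; ring
    choose p hpdeg hpbd hperr using exists_polynomial_of_regular hε hε1 hm
    -- Once the coordinates in `H` are fixed to those of `y`, the normalised tail form `a` faces
    -- this shifted and rescaled threshold.
    set q : Cube n → Polynomial ℝ := fun y => p ((θ - linForm (headPart v H) y) / s) with hq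
    refine ⟨blend H a q, totalDegree_blend_le H a fun y => hpdeg _, fun x => ?_,
      fun k D hk hD => ?_⟩
    · refine (abs_eval_blend_le fun y => hpbd _ n _ (by exact_mod_cast hn)
        (abs_linForm_le (fun i => (haε i).trans hε1) x)).trans ?_
      linarith
    · refine expect_abs_blend_sub_le fun y => ?_
      have hw : MatchesMoments (fun x => (D x).toReal * agreeKer H x y) a (2 * m + 2) :=
        ⟨fun x => mul_nonneg ENNReal.toReal_nonneg (agreeKer_nonneg H x y), fun j hj => by
          rw [← hD.expect_agreeKer_mul_linForm_pow haH (by omega) y]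
          exact Finset.sum_congr rfl fun x _ => mul_assoc _ _ _⟩
      refine le_trans (le_of_eq ?_) (hperr ((θ - linForm (headPart v H) y) / s) n a ha2 haε _ hw)
      refine Finset.sum_congr rfl fun x _ => ?_
      by_cases h : agreeKer H x y = 0
      · simp [h]
      · have h1 : sgn (linForm v x - θ) =
            sgn (linForm a x - (θ - linForm (headPart v H) y) / s) := by
          rw [haX, ← sub_div, sgn_div hs0, linForm_eq_head_add_tail v H x,
            linForm_headPart_eq_of_agreeKer_ne_zero h]
          congr 1; ring
        rw [h1]

/-- Polynomial approximation of halfspaces under `k`-wise independent distributions. -/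
lemma exists_approx {v : Fin n → ℝ} (hv : ∑ i, v i ^ 2 = 1) {ε : ℝ} (hε : 0 < ε)
    (hε1 : 3 * ε ≤ 1) (hn : 1 ≤ n) {m g M : ℕ} (hm : 9 / ε ^ 4 ≤ m)
    (hg : (1 - ε ^ 2) ^ g ≤ ε ^ 4) (hM : ((2 : ℝ) ^ M)⁻¹ ≤ ε) (θ : ℝ) :
    ∃ P : MvPolynomial (Fin n) ℝ, P.totalDegree ≤ M * (g + 1) + 2 * m ∧
      (∀ x : Cube n, |MvPolynomial.eval (toReal x) P| ≤
        1 + 4 * m * ((n + 1 / ε) / ε ^ 2) ^ (2 * m)) ∧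
      ∀ (k : ℕ) (D : PMF (Cube n)), M * (g + 1) + 2 * m + 2 ≤ k → KWiseIndependent k D →
        expect D (fun x => |MvPolynomial.eval (toReal x) P - sgn (linForm v x - θ)|) ≤
          104 * ε := by
  obtain ⟨H, hH, hreg | ⟨J, hJH, hJ, ρ, hρ, htail, hsep⟩⟩ :=
    exists_regularOutside_or_separates hv hε hε1 hg M
  · obtain ⟨P, h1, h2, h3⟩ :=
      exists_approx_of_regularOutside hε (by linarith) hreg hn hm θ
    exact ⟨P, h1.trans (by omega), h2, fun k D hk hD => h3 k D (by omega) hD⟩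
  · refine ⟨headPoly v H θ, (totalDegree_headPoly_le v H θ).trans (by omega), fun x => ?_,
      fun k D hk hD => ?_⟩
    · rw [eval_headPoly, abs_sgn]
      have : 0 ≤ 4 * m * ((n + 1 / ε) / ε ^ 2) ^ (2 * m) := by positivity
      linarith
    · simp only [eval_headPoly]
      refine (expect_abs_sgn_headPart_sub_le hρ hJH hsep htail (by omega) (by omega) hD θ).trans ?_
      rw [hJ]
      nlinarith

/-! ### Choice of parameters and the passage to almost `k`-wise independence -/

lemma exp_neg_one_div_le {ε : ℝ} (hε : 0 < ε) : Real.exp (-(1 / ε)) ≤ ε := by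
  rw [Real.exp_neg]
  refine inv_le_of_inv_le₀ hε ?_
  rw [← one_div]
  linarith [Real.add_one_le_exp (1 / ε)]

lemma inv_two_pow_ceil_le {ε : ℝ} (hε : 0 < ε) : ((2 : ℝ) ^ ⌈1 / ε⌉₊)⁻¹ ≤ ε := by
  refine inv_le_of_inv_le₀ hε ?_
  rw [← one_div]
  refine (Nat.le_ceil _).trans ?_
  exact_mod_cast Nat.lt_two_pow_self.le

/-- The power is at most `exp (-4/ε) ≤ ε⁴`. Logarithmic savings in `g` and `M` are not needed: `M (g
+ 1)` is already of order `ε⁻⁴`, like `m`. -/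
lemma one_sub_sq_pow_ceil_le {ε : ℝ} (hε : 0 < ε) (hε1 : ε ≤ 1) :
    (1 - ε ^ 2) ^ ⌈4 / ε ^ 3⌉₊ ≤ ε ^ 4 := by
  have h1 : 1 - ε ^ 2 ≤ Real.exp (-ε ^ 2) := by linarith [Real.add_one_le_exp (-ε ^ 2)]
  have h0 : 0 ≤ 1 - ε ^ 2 := by nlinarith
  calc (1 - ε ^ 2) ^ ⌈4 / ε ^ 3⌉₊ ≤ Real.exp (-ε ^ 2) ^ ⌈4 / ε ^ 3⌉₊ :=
        pow_le_pow_left₀ h0 h1 _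
    _ = Real.exp (⌈4 / ε ^ 3⌉₊ * (-ε ^ 2)) := by rw [Real.exp_nat_mul]
    _ ≤ Real.exp ((4 : ℕ) * (-(1 / ε))) := by
        refine Real.exp_le_exp.2 ?_
        have h2 := mul_le_mul_of_nonneg_right (Nat.le_ceil (4 / ε ^ 3)) (sq_nonneg ε)
        have h3 : 4 / ε ^ 3 * ε ^ 2 = 4 * (1 / ε) := by field_simp
        rw [h3] at h2
        push_cast
        linarith
    _ = Real.exp (-(1 / ε)) ^ 4 := Real.exp_nat_mul _ _
    _ ≤ ε ^ 4 := pow_le_pow_left₀ (Real.exp_pos _).le (exp_neg_one_div_le hε) 4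

/-- For such `n` the base is at most `n³`, so the polynomial is at most `n ^ (6m + 2)` on the cube.
The factor `n ^ (-(6m + 5))` leaves `2 n⁻³ ≤ n⁻¹ ≤ ε`. -/
lemma growth_mul_rpow_le {n m : ℕ} {ε E : ℝ} (hε : 0 < ε) (hε1 : 3 * ε ≤ 1)
    (hn : 40 / ε ^ 4 ≤ n) (hm : (m : ℝ) ≤ 10 / ε ^ 4) (hE : 6 * (m : ℝ) + 5 ≤ E) :
    2 * (n : ℝ) ^ (-E) * (2 + 4 * m * ((n + 1 / ε) / ε ^ 2) ^ (2 * m)) ≤ ε := by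
  have hε1' : ε ≤ 1 := by linarith
  have h1 : 1 ≤ 1 / ε ^ 4 := by
    rw [le_div_iff₀ (by positivity), one_mul]; exact pow_le_one₀ hε.le hε1'
  have h2 : 40 / ε ^ 4 = 40 * (1 / ε ^ 4) := by ring
  have h3 : 10 / ε ^ 4 = 10 * (1 / ε ^ 4) := by ring
  have h4 : 1 / ε ≤ 1 / ε ^ 4 :=
    one_div_le_one_div_of_le (by positivity) (pow_le_of_le_one hε.le hε1' (by norm_num))
  have h5 : 1 / ε ^ 2 ≤ 1 / ε ^ 4 :=
    one_div_le_one_div_of_le (by positivity) (pow_le_pow_of_le_one hε.le hε1' (by norm_num))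
  set N : ℝ := (n : ℝ) with hN
  have hN40 : 40 ≤ N := by linarith
  have hN0 : 0 < N := by linarith
  have hW0 : 0 ≤ (N + 1 / ε) / ε ^ 2 := by positivity
  have hW : (N + 1 / ε) / ε ^ 2 ≤ N ^ 3 := by
    have h6 : (N + 1 / ε) / ε ^ 2 = (N + 1 / ε) * (1 / ε ^ 2) := by ring
    rw [h6]
    calc (N + 1 / ε) * (1 / ε ^ 2) ≤ (N + N) * N := by
          gcongr
          · linarith
          · linarith
      _ ≤ N ^ 3 := by nlinarith [sq_nonneg N]
  have hWm : ((N + 1 / ε) / ε ^ 2) ^ (2 * m) ≤ N ^ (6 * m) := by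
    calc _ ≤ (N ^ 3) ^ (2 * m) := pow_le_pow_left₀ hW0 hW _
      _ = N ^ (6 * m) := by rw [← pow_mul]; congr 1; ring
  have hpow1 : 1 ≤ N ^ (6 * m) := one_le_pow₀ (by linarith)
  have hB : 2 + 4 * m * ((N + 1 / ε) / ε ^ 2) ^ (2 * m) ≤ N ^ (6 * m + 2) := by
    calc _ ≤ 2 * N ^ (6 * m) + N * N ^ (6 * m) := by
          gcongr
          · linarith
          · linarith
      _ = (2 + N) * N ^ (6 * m) := by ring
      _ ≤ N ^ 2 * N ^ (6 * m) := by gcongr; nlinarith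
      _ = _ := by ring
  have hE' : N ^ (-E) ≤ (N ^ (6 * m + 5))⁻¹ := by
    rw [Real.rpow_neg hN0.le]
    refine inv_anti₀ (by positivity) ?_
    rw [← Real.rpow_natCast]
    refine Real.rpow_le_rpow_of_exponent_le (by linarith) ?_
    push_cast
    exact hE
  calc _ ≤ 2 * (N ^ (6 * m + 5))⁻¹ * N ^ (6 * m + 2) := by
        gcongr
    _ = 2 * (N ^ 3)⁻¹ := by
        have : N ^ (6 * m + 5) = N ^ (6 * m + 2) * N ^ 3 := by ring
        rw [this]
        field_simp
    _ ≤ N⁻¹ := by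
        rw [← div_eq_mul_inv, div_le_iff₀ (by positivity)]
        have : N⁻¹ * N ^ 3 = N ^ 2 := by field_simp
        rw [this]; nlinarith
    _ ≤ ε := by
        refine inv_le_of_inv_le₀ hε ?_
        rw [← one_div]; linarith

lemma sum_sq_eq_one_of_norm_eq_one {v : EuclideanSpace ℝ (Fin n)} (hv : ‖v‖ = 1) :
    ∑ i, v i ^ 2 = 1 := by
  rw [← EuclideanSpace.real_norm_sq_eq, hv, one_pow]

lemma exists_approx_of_closeToKWiseIndependent {ε : ℝ} (hε : 0 < ε)
    (hε1 : 3 * ε ≤ 1) (hlog : 100 ≤ Real.log (1 / ε)) (v : EuclideanSpace ℝ (Fin n)) (θ : ℝ)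
    (hv : ‖v‖ = 1) (D : PMF (Cube n))
    (hD : CloseToKWiseIndependent ((n : ℝ) ^ (-(42 / ε ^ 4 * Real.log (1 / ε) ^ 2)))
      ⌊1 / (50 * ε ^ 4) * Real.log (1 / ε) ^ 4⌋₊ D) :
    ∃ P : MvPolynomial (Fin n) ℝ,
      (P.totalDegree : ℝ) ≤ 20 / ε ^ 4 * Real.log (1 / ε) ^ 2 ∧
      expect D (fun x => |MvPolynomial.eval (toReal x) P - halfspace v θ x|) ≤ 105 * ε := by
  have hhalf : ∀ x, halfspace v θ x = sgn (linForm (fun i => v i) x - θ) := fun _ => rfl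
  have hε1' : ε ≤ 1 := by linarith
  set l := Real.log (1 / ε) with hl
  set A : ℝ := 1 / ε ^ 4 with hA
  have hA0 : 0 < A := by positivity
  have hdiv : ∀ c : ℝ, c / ε ^ 4 = c * A := fun c => by rw [hA]; ring
  have hl2 : (10000 : ℝ) ≤ l ^ 2 := by nlinarith
  -- For `n` below the permitted degree the halfspace is itself a polynomial of degree at most `n`.
  -- Otherwise `n` is large enough for the total variation term; the bound `log² ≥ 10000` absorbs
  -- all numerical constants.
  rcases le_or_gt (n : ℝ) (20 / ε ^ 4 * l ^ 2) with hsmall | hbig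
  · refine ⟨headPoly (fun i => v i) Finset.univ θ, ?_, ?_⟩
    · refine le_trans ?_ hsmall
      have := totalDegree_headPoly_le (fun i => v i) Finset.univ θ
      rw [Finset.card_univ, Fintype.card_fin] at this
      exact_mod_cast this
    · simp only [eval_headPoly, headPart_univ, hhalf, sub_self, abs_zero, expect_const]
      positivity
  · have hA1 : 81 ≤ A := by
      rw [hA, le_div_iff₀ (by positivity)]
      have h1 : ε ^ 4 ≤ (1 / 3) ^ 4 := pow_le_pow_left₀ hε.le (by linarith) 4
      linarith
    have hinv : 1 / ε ≤ A :=
      one_div_le_one_div_of_le (by positivity) (pow_le_of_le_one hε.le hε1' (by norm_num))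
    rw [hdiv] at hbig
    set m := ⌈9 / ε ^ 4⌉₊ with hm
    set g := ⌈4 / ε ^ 3⌉₊ with hg
    set M := ⌈1 / ε⌉₊ with hM
    have hm' : (m : ℝ) ≤ 10 * A := by
      have := (Nat.ceil_lt_add_one (by positivity : 0 ≤ 9 / ε ^ 4)).le
      rw [hdiv] at this
      rw [hm, hdiv]; linarith
    have hMg : ((M * (g + 1) : ℕ) : ℝ) ≤ 12 * A := by
      have h1 : (M : ℝ) ≤ 1 / ε + 1 := (Nat.ceil_lt_add_one (by positivity)).le
      have h2 : (g : ℝ) ≤ 4 / ε ^ 3 + 1 := (Nat.ceil_lt_add_one (by positivity)).le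
      have h3 : 3 ≤ 1 / ε := by rw [le_div_iff₀ hε]; exact hε1
      have h4 : 4 / ε ^ 3 = 4 * (1 / ε) ^ 3 := by ring
      have h5 : A = (1 / ε) ^ 4 := by rw [hA]; ring
      rw [h4] at h2
      rw [h5]
      set z := 1 / ε
      push_cast
      calc (M : ℝ) * (g + 1) ≤ (z + 1) * (4 * z ^ 3 + 2) := by
              refine mul_le_mul h1 (by linarith) (by positivity) (by linarith)
        _ ≤ (z + z) * (4 * z ^ 3 + z ^ 3) := by
            have : 3 ^ 3 ≤ z ^ 3 := by gcongr
            gcongr <;> linarith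
        _ = 10 * z ^ 4 := by ring
        _ ≤ 12 * z ^ 4 := by
            have : 0 ≤ z ^ 4 := by positivity
            linarith
    have hn : 1 ≤ n := by
      have : (0 : ℝ) < n := lt_of_le_of_lt (by positivity) hbig
      exact_mod_cast this
    obtain ⟨P, hdeg, hbd, herr⟩ := exists_approx (sum_sq_eq_one_of_norm_eq_one hv) hε hε1 hn
      (Nat.le_ceil _) (one_sub_sq_pow_ceil_le hε hε1') (inv_two_pow_ceil_le hε) θ
    refine ⟨P, ?_, ?_⟩
    · have h1 : (P.totalDegree : ℝ) ≤ ((M * (g + 1) : ℕ) : ℝ) + 2 * m := by exact_mod_cast hdeg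
      rw [hdiv]
      nlinarith
    · obtain ⟨D', hD', htv⟩ := hD
      have hk : M * (g + 1) + 2 * m + 2 ≤ ⌊1 / (50 * ε ^ 4) * l ^ 4⌋₊ := by
        refine Nat.le_floor ?_
        have h1 : 1 / (50 * ε ^ 4) = A / 50 := by rw [hA]; field_simp
        have h2 : l ^ 4 = l ^ 2 * l ^ 2 := by ring
        have h3 : (10000 : ℝ) * 10000 ≤ l ^ 2 * l ^ 2 := by gcongr
        rw [h1, h2]
        push_cast at hMg ⊢
        nlinarith
      have herr' := herr _ D' hk hD'
      have hB : ∀ x : Cube n, |(|MvPolynomial.eval (toReal x) P -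
          sgn (linForm (fun i => v i) x - θ)|)| ≤
          2 + 4 * m * ((n + 1 / ε) / ε ^ 2) ^ (2 * m) := by
        intro x
        rw [abs_abs]
        refine (abs_sub _ _).trans ?_
        rw [abs_sgn]
        linarith [hbd x]
      have hgrow := growth_mul_rpow_le (n := n) (m := m) (E := 42 / ε ^ 4 * l ^ 2) hε hε1
        (by rw [hdiv]; nlinarith) (by rw [hdiv]; exact hm') (by rw [hdiv]; nlinarith)
      have h1 := abs_expect_sub_le D D' hB
      have h2 : 2 * tvDist D D' * (2 + 4 * m * ((n + 1 / ε) / ε ^ 2) ^ (2 * m)) ≤ ε := by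
        refine le_trans ?_ hgrow
        gcongr
      simp only [hhalf]
      linarith

end HalfspaceApprox

end

theorem mainTheorem7 :
    ∃ C : ℝ, 0 < C ∧ ∀ ε : ℝ, 0 < ε → ε < 1 →
      ∀ (n : ℕ) (v : EuclideanSpace ℝ (Fin n)) (θ : ℝ), ‖v‖ = 1 →
      ∀ D : PMF (HalfspaceApprox.Cube n),
        HalfspaceApprox.CloseToKWiseIndependent
          ((n : ℝ) ^ (-(42 / ε ^ 4 * Real.log (1 / ε) ^ 2)))
          ⌊1 / (50 * ε ^ 4) * Real.log (1 / ε) ^ 4⌋₊ D →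
        ∃ P : MvPolynomial (Fin n) ℝ,
          (P.totalDegree : ℝ) ≤ 20 / ε ^ 4 * Real.log (1 / ε) ^ 2 ∧
          HalfspaceApprox.expect D (fun x =>
            |MvPolynomial.eval (HalfspaceApprox.toReal x) P -
              HalfspaceApprox.halfspace v θ x|) ≤ C * ε := by
  -- The summand `3 exp 100` disposes of large `ε`, where the zero polynomial has error exactly `1`;
  -- for the remaining `ε`, `3ε ≤ 1` and `log (1/ε) ≥ 100`.
  refine ⟨105 + 3 * Real.exp 100, by positivity, fun ε hε hε1 n v θ hv D hD => ?_⟩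
  have hexp : 0 < Real.exp 100 := Real.exp_pos _
  by_cases h : 3 * Real.exp 100 * ε ≤ 1
  · have h1 : 1 ≤ Real.exp 100 := Real.one_le_exp (by norm_num)
    have hlog : 100 ≤ Real.log (1 / ε) := by
      rw [Real.le_log_iff_exp_le (by positivity), le_div_iff₀ hε]
      nlinarith
    obtain ⟨P, hdeg, herr⟩ := HalfspaceApprox.exists_approx_of_closeToKWiseIndependent hε
      (by nlinarith) hlog v θ hv D hD
    exact ⟨P, hdeg, herr.trans (by nlinarith)⟩
  · refine ⟨0, by rw [MvPolynomial.totalDegree_zero, Nat.cast_zero]; positivity, ?_⟩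
    have h1 : ∀ x, |MvPolynomial.eval (HalfspaceApprox.toReal x) 0 -
        HalfspaceApprox.halfspace v θ x| = 1 := by
      intro x
      rw [map_zero, zero_sub, abs_neg]
      exact HalfspaceApprox.abs_sgn _
    simp only [h1, HalfspaceApprox.expect_const]
    nlinarith
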